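/- Let $n\ge 1$, let $\alpha=(\alpha_1,\dots,\alpha_k)$ be a composition of $n$ (a sequence of positive integers with sum $n$), and let $A,B$ be complementary subsets of $[k]=\{1,\dots,k\}$, i.e. $A\cup B=[k]$, $A\cap B=\emptyset$. An $\alpha$-permutation is a sequence $a_1a_2\cdots a_n$ in which each $i\in[k]$ occurs exactly $\alpha_i$ times, that is, a permutation of the multiset $\{1^{\alpha_1},\dots,k^{\alpha_k}\}$. It is $(A,B)$-alternating if $a_1>a_2<a_3>a_4<\cdots a_n$, and reverse $(A,B)$-alternating if $a_1<a_2>a_3<a_4>\cdots a_n$, where for equal letters $j>j$ is declared to hold exactly when $j\in A$ and $j<j$ exactly when $j\in B$ (distinct letters are compared as usual). Let $N(\alpha,A,B)$ and $N^*(\alpha,A,B)$ be the numbers of $(A,B)$-alternating and of reverse $(A,B)$-alternating $\alpha$-permutations. Let $e_i$, $h_i$ and $p_i$ be the elementary, complete and power sum symmetric functions of degree $i$ in variables $x_1,x_2,\dots$ over $\mathbb{Q}$. For a symmetric function $f$, written uniquely as a polynomial $P(p_1,p_2,\dots)$ with rational coefficients, let $f[a_1,a_2,\dots]=P(a_1,a_2,\dots)$.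 Let $E_m$ be the Euler number, i.e. the number of permutations $w_1\cdots w_m$ of $1,\dots,m$ with $w_1>w_2<w_3>\cdots$ ($E_0=1$). A polynomial in the symbol $E$ is evaluated umbrally: it is first expanded completely in powers of $E$, and then each $E^m$ (including $E^0$) is replaced by the number $E_m$. Put $$F=\prod_{i\in A}e_{\alpha_i}\cdot\prod_{j\in B}h_{\alpha_j}.$$ (a) If $n$ is odd, then $$N(\alpha,A,B)=N^*(\alpha,A,B)=F[E,0,-E,0,E,0,-E,0,\dots].$$ (b) If $n$ is even, then $$N(\alpha,A,B)=F[E,-1,-E,1,E,-1,-E,1,\dots],\qquad N^*(\alpha,A,B)=F[E,1,-E,-1,E,1,-E,-1,\dots].$$ In each case the sequence in brackets has period $4$ and the right-hand side is evaluated umbrally. -/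

import Mathlib

open Polynomial

noncomputable section

namespace UmbralAlternating

/-! ### Alternating words -/

/-- The word `a₁ a₂ ⋯ aₙ` satisfies `desc a₁ a₂`, `asc a₂ a₃`, `desc a₃ a₄`, and so on
(the letters are indexed from `0` here, so `desc` is imposed at the even positions). -/
def AlternatesBy {S : Type*} {n : ℕ} (desc asc : S → S → Prop) (a : Fin n → S) : Prop :=
  ∀ (i : Fin n) (h : (i : ℕ) + 1 < n),
    if Even (i : ℕ) then desc (a i) (a ⟨i + 1, h⟩) else asc (a i) (a ⟨i + 1, h⟩)

/-- The Euler number `Eₙ`: the number of permutations of an `n`-element chain with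
`a₁ > a₂ < a₃ > a₄ < ⋯`. -/
def eulerNumber (n : ℕ) : ℕ :=
  Nat.card {w : Equiv.Perm (Fin n) // AlternatesBy (· > ·) (· < ·) (w : Fin n → Fin n)}

/-- The relation `a > b`, with `j > j` declared to hold exactly for `j ∈ A`. -/
def DescRel {k : ℕ} (A : Finset (Fin k)) (a b : Fin k) : Prop :=
  b < a ∨ (a = b ∧ a ∈ A)

/-- The relation `a < b`, with `j < j` declared to hold exactly for `j ∈ B`. -/
def AscRel {k : ℕ} (B : Finset (Fin k)) (a b : Fin k) : Prop :=
  a < b ∨ (a = b ∧ a ∈ B)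

/-- `w` is a permutation of the multiset in which `i` occurs `αᵢ` times. -/
def IsMultisetPerm {n : ℕ} (α : Composition n) (w : Fin n → Fin α.length) : Prop :=
  ∀ j : Fin α.length, (Finset.univ.filter fun i => w i = j).card = α.blocksFun j

/-- `N(α, A, B)`: the number of `α`-permutations with `a₁ > a₂ < a₃ > ⋯`. -/
def altCount {n : ℕ} (α : Composition n) (A B : Finset (Fin α.length)) : ℕ :=
  Nat.card {w : Fin n → Fin α.length //
    IsMultisetPerm α w ∧ AlternatesBy (DescRel A) (AscRel B) w}

/-- `N*(α, A, B)`: the number of `α`-permutations with `a₁ < a₂ > a₃ < ⋯`. -/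
def revAltCount {n : ℕ} (α : Composition n) (A B : Finset (Fin α.length)) : ℕ :=
  Nat.card {w : Fin n → Fin α.length //
    IsMultisetPerm α w ∧ AlternatesBy (AscRel B) (DescRel A) w}

/-! ### Symmetric functions in the variables `x₀, x₁, x₂, …` over `ℚ` -/

open Classical in
/-- The elementary symmetric function `e_m`: the sum of all squarefree monomials of degree `m`. -/
def elemSymm (m : ℕ) : MvPowerSeries ℕ ℚ :=
  fun d => if d.degree = m ∧ ∀ i, d i ≤ 1 then 1 else 0

open Classical in
/-- The complete symmetric function `h_m`: the sum of all monomials of degree `m`. -/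
def complSymm (m : ℕ) : MvPowerSeries ℕ ℚ :=
  fun d => if d.degree = m then 1 else 0

open Classical in
/-- The power sum `p_m = ∑ᵢ xᵢ ^ m`, for `m ≥ 1`. -/
def powerSum (m : ℕ) : MvPowerSeries ℕ ℚ :=
  fun d => if ∃ i, d = Finsupp.single i m then 1 else 0

/-- `P(p₁, p₂, …)`, where the variable of `P` with index `i` stands for `p_{i+1}`. -/
def evalPowerSums : MvPolynomial ℕ ℚ →ₐ[ℚ] MvPowerSeries ℕ ℚ :=
  MvPolynomial.aeval fun i => powerSum (i + 1)

open Classical in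
/-- The symmetric function `f` regarded as a polynomial in the power sums, that is, the
polynomial `P` with `P(p₁, p₂, …) = f` (and `0` if `f` is no such expression). -/
def powerSumPoly (f : MvPowerSeries ℕ ℚ) : MvPolynomial ℕ ℚ :=
  if h : ∃ P, evalPowerSums P = f then h.choose else 0

/-- `f[a₁, a₂, …]`, the result of substituting `aᵢ` for `pᵢ` in `f` (`a i` here is `a_{i+1}`);
the substituted quantities are polynomials in the umbral variable `E`. -/
def bracket (f : MvPowerSeries ℕ ℚ) (a : ℕ → ℚ[X]) : ℚ[X] :=
  MvPolynomial.aeval a (powerSumPoly f)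

/-! ### Umbral evaluation -/

/-- Replace `E ^ k` by the Euler number `E_k` in a polynomial in `E`. -/
def umbral (q : ℚ[X]) : ℚ :=
  q.sum fun k c => c * (eulerNumber k : ℚ)

/-- The sequence `a, b, c, d, a, b, c, d, …`. -/
def periodicSeq (a b c d : ℚ[X]) (i : ℕ) : ℚ[X] :=
  ![a, b, c, d] (Fin.ofNat 4 i)

/-- `∏_{i ∈ A} e_{αᵢ} · ∏_{j ∈ B} h_{αⱼ}`. -/
def symmProd {n : ℕ} (α : Composition n) (A B : Finset (Fin α.length)) : MvPowerSeries ℕ ℚ :=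
  (∏ i ∈ A, elemSymm (α.blocksFun i)) * ∏ j ∈ B, complSymm (α.blocksFun j)

end UmbralAlternating

end

open Finset.HasAntidiagonal (antidiagonal mem_antidiagonal)

/-! Take one variable `x_j` per letter and put θ = ∑ arctan x_j and Λ = ½ ∑ b_j log(1 + x_j²), where
b_j = 1 if the relation `P` lets the letter j follow itself and b_j = -1 otherwise. A word all of
whose steps satisfy `P` is determined by its content, so these chains have the generating function ∏
1/(1 - x_j) · ∏ (1 + x_j), the first product over b_j = 1 and the second over b_j = -1. Replacing
x_j by I x_j turns it into exp(Iθ - Λ), so its signed even and odd parts are e^{-Λ} cos θ and e^{-Λ}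
sin θ (`coeff_arctanProd_I`, `chainCos_eq`, `chainSin_eq`).

Since `Q` is the negation of `P`, gluing a chain of even length to an alternating word gives a
telescoping sum, and `chainCos_mul_altSeries` follows. Hence the alternating words have the series
(1 + e^{-Λ} sin θ) / (e^{-Λ} cos θ) = e^{Λ} sec θ + tan θ. The first summand is even and the second
is odd and free of b; this is why the two counts agree for odd n.

On the symmetric function side, substituting c, b, -c, -b, … for the power sums makes ∑ h_m x^m
equal to exp(c arctan x + ½ b log(1 + x²)), and passing from h to e changes the sign of b. So the
bracket of F is a coefficient of exp(Eθ + Λ) for suitable b (`umbral_bracket_symmProd`). Umbrally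
e^{Ez} becomes sec z + tan z, which gives e^{Λ}(sec θ + tan θ): its even part is the one above, and
with b = 0 so is its odd part (`coeff_altSeries_of_even`, `coeff_altSeries_of_odd`).

The umbral functional is first defined by the recursion for sec + tan. That its values are the Euler
numbers comes from the same comparison, applied to words with distinct letters
(`secTan_eq_eulerNumber`). The bracket can be computed from any expression in power sums because
these are algebraically independent (`evalPowerSums_injective`). -/

namespace UmbralAlternating

/-! ### Newton's recursion -/

section Newton

variable {R : Type*} [CommRing R] [Algebra ℚ R]

/-- The sequence `h₀, h₁, …` determined by `h₀ = 1` and Newton's identities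
`(m + 1) h_{m+1} = ∑_{i ≤ m} p_{i+1} h_{m-i}`, where `p_{i+1} = a i`. -/
noncomputable def newton (a : ℕ → R) : ℕ → R
  | 0 => 1
  | m + 1 => ((m + 1 : ℚ)⁻¹) • ∑ i : Fin (m + 1), a i * newton a (m - i)

@[simp] lemma newton_zero (a : ℕ → R) : newton a 0 = 1 := by rw [newton]

lemma newton_succ (a : ℕ → R) (m : ℕ) :
    ((m : R) + 1) * newton a (m + 1) = ∑ i ∈ Finset.range (m + 1), a i * newton a (m - i) := by
  rw [newton, Finset.sum_range (fun i => a i * newton a (m - i))]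
  have h : ((m : R) + 1) = algebraMap ℚ R (m + 1) := by simp
  have h0 : (m + 1 : ℚ) ≠ 0 := by positivity
  rw [h, ← Algebra.smul_def, smul_smul, mul_inv_cancel₀ h0, one_smul]

lemma natCast_add_one_mul_cancel {m : ℕ} {x y : R} (h : ((m : R) + 1) * x = (m + 1) * y) :
    x = y := by
  have h1 : ((m : R) + 1) = algebraMap ℚ R (m + 1) := by simp
  have h0 : (m + 1 : ℚ) ≠ 0 := by positivity
  rw [h1, ← Algebra.smul_def, ← Algebra.smul_def] at h
  simpa [smul_smul, inv_mul_cancel₀ h0] using congrArg (fun z => (m + 1 : ℚ)⁻¹ • z) h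

/-- The recursion determines its solution because m + 1 is invertible over ℚ. Every closed form of a
`newton` sequence below is obtained through this uniqueness. -/
lemma eq_newton {a f : ℕ → R} (h0 : f 0 = 1)
    (h : ∀ m : ℕ, ((m : R) + 1) * f (m + 1) = ∑ i ∈ Finset.range (m + 1), a i * f (m - i)) :
    f = newton a := by
  funext m
  induction m using Nat.strong_induction_on with
  | _ m ih =>
    cases m with
    | zero => simp [h0]
    | succ m =>
      apply natCast_add_one_mul_cancel (m := m)
      rw [h, newton_succ]
      refine Finset.sum_congr rfl fun i _ => ?_
      rw [ih (m - i) (by omega)]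

lemma map_newton {S : Type*} [CommRing S] [Algebra ℚ S] (φ : R →+* S) (a : ℕ → R) (m : ℕ) :
    φ (newton a m) = newton (fun i => φ (a i)) m := by
  refine congrFun (eq_newton (f := fun m => φ (newton a m)) (by simp) fun m => ?_) m
  simpa using congrArg φ (newton_succ a m)

/-- This is the substitution x ↦ u x in exp(∑ a_i x^{i+1}/(i+1)). -/
lemma newton_pow_mul (u : R) (a : ℕ → R) (m : ℕ) :
    newton (fun i => u ^ (i + 1) * a i) m = u ^ m * newton a m := by
  refine (congrFun (eq_newton (f := fun m => u ^ m * newton a m) (by simp) fun m => ?_) m).symm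
  rw [mul_left_comm, newton_succ, Finset.mul_sum]
  refine Finset.sum_congr rfl fun i hi => ?_
  have : m + 1 = (i + 1) + (m - i) := by
    have := Finset.mem_range.mp hi
    omega
  rw [this, pow_add]
  ring

lemma newton_geometric (u : R) (m : ℕ) : newton (fun i => u ^ (i + 1)) m = u ^ m := by
  refine (congrFun (eq_newton (f := fun m => u ^ m) (by simp) fun m => ?_) m).symm
  rw [Finset.sum_congr rfl (g := fun _ => u ^ (m + 1)) fun i hi => ?_]
  · simp
  · rw [← pow_add]
    congr 1
    have := Finset.mem_range.mp hi
    omega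

/-- The series is exp(log(1 + x)) = 1 + x. -/
lemma newton_alternating_one (m : ℕ) :
    newton (fun i => (-1 : R) ^ i) m = if m ≤ 1 then 1 else 0 := by
  refine (congrFun (eq_newton (f := fun m => if m ≤ 1 then (1 : R) else 0)
    (by simp) fun m => ?_) m).symm
  rcases m with _ | m
  · simp
  rw [Finset.sum_range_succ, Finset.sum_range_succ, Finset.sum_eq_zero fun i hi => ?_]
  · simp [pow_succ]
  · have := Finset.mem_range.mp hi
    rw [if_neg (by omega), mul_zero]

open PowerSeries in
lemma derivative_mk_newton (a : ℕ → R) :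
    PowerSeries.derivative R (PowerSeries.mk (newton a)) =
      PowerSeries.mk a * PowerSeries.mk (newton a) := by
  ext m
  rw [PowerSeries.coeff_derivative, PowerSeries.coeff_mk, mul_comm, newton_succ,
    PowerSeries.coeff_mul, Finset.Nat.sum_antidiagonal_eq_sum_range_succ_mk]
  simp

/-- Exponentials turn sums into products: the logarithmic derivative of the product is the sum of
the two, and `eq_newton` says that it determines the series. -/
lemma mk_newton_add (a b : ℕ → R) :
    PowerSeries.mk (newton (a + b)) = PowerSeries.mk (newton a) * PowerSeries.mk (newton b) := by
  set F := PowerSeries.mk (newton a) * PowerSeries.mk (newton b) with hF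
  have hd : PowerSeries.derivative R F = PowerSeries.mk (a + b) * F := by
    have : PowerSeries.mk (a + b) = PowerSeries.mk a + PowerSeries.mk b := by
      ext; simp
    rw [hF, Derivation.leibniz, derivative_mk_newton, derivative_mk_newton, this]
    simp only [smul_eq_mul]
    ring
  have : (fun m => PowerSeries.coeff m F) = newton (a + b) := by
    refine eq_newton (by simp [hF]) fun m => ?_
    have h := congrArg (PowerSeries.coeff m) hd
    rw [PowerSeries.coeff_derivative, PowerSeries.coeff_mul (φ := PowerSeries.mk (a + b)),
      Finset.Nat.sum_antidiagonal_eq_sum_range_succ_mk] at h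
    rw [mul_comm, h]
    simp
  ext m
  simp [← this]

lemma newton_add (a b : ℕ → R) (m : ℕ) :
    newton (a + b) m = ∑ p ∈ antidiagonal m, newton a p.1 * newton b p.2 := by
  simpa [PowerSeries.coeff_mul] using congrArg (PowerSeries.coeff m) (mk_newton_add a b)

/-! ### Products over the variables -/

/-- The multivariate power series whose coefficients are products of the terms of given
sequences, one for each variable. -/
noncomputable def newtonProd {ι : Type*} [Fintype ι] (a : ι → ℕ → R) : MvPowerSeries ι R :=
  fun d => ∏ j, newton (a j) (d j)

lemma coeff_newtonProd {ι : Type*} [Fintype ι] (a : ι → ℕ → R) (d : ι →₀ ℕ) :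
    MvPowerSeries.coeff d (newtonProd a) = ∏ j, newton (a j) (d j) := rfl

lemma newtonProd_mul {ι : Type*} [Fintype ι] (a b : ι → ℕ → R) :
    newtonProd a * newtonProd b = newtonProd (a + b) := by
  classical
  ext d
  rw [MvPowerSeries.coeff_mul, coeff_newtonProd]
  simp only [Pi.add_apply, newton_add, Finset.prod_univ_sum, coeff_newtonProd,
    ← Finset.prod_mul_distrib]
  refine Finset.sum_bij' (fun p _ j => (p.1 j, p.2 j))
    (fun q _ => (Finsupp.equivFunOnFinite.symm fun j => (q j).1,
      Finsupp.equivFunOnFinite.symm fun j => (q j).2)) ?_ ?_ ?_ ?_ ?_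
  · intro p hp
    rw [mem_antidiagonal] at hp
    simp [← hp]
  · intro q hq
    rw [mem_antidiagonal]
    ext j
    simpa using Fintype.mem_piFinset.mp hq j
  · intro p _
    ext <;> simp
  · intro q _
    ext <;> simp
  · intro p _
    rfl

end Newton

/-! ### Words and their generating functions -/

section Words

variable {ι : Type*} {n : ℕ}

/-- The number of occurrences of each letter in a word. -/
noncomputable def content (w : Fin n → ι) : ι →₀ ℕ := ∑ i, Finsupp.single (w i) 1

lemma content_apply [DecidableEq ι] (w : Fin n → ι) (j : ι) :
    content w j = (Finset.univ.filter fun i => w i = j).card := by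
  simp [content, Finsupp.finsetSum_apply, Finsupp.single_apply, Finset.sum_boole]

@[simp] lemma degree_content (w : Fin n → ι) : (content w).degree = n := by
  simp [content, map_sum]

/-- Consecutive letters at the positions `i`, `i + 1` are related by `rel i`. -/
def StepsBy (rel : ℕ → ι → ι → Prop) (w : Fin n → ι) : Prop :=
  ∀ (i : ℕ) (h : i + 1 < n), rel i (w ⟨i, by omega⟩) (w ⟨i + 1, h⟩)

lemma alternatesBy_iff_stepsBy (P Q : ι → ι → Prop) (w : Fin n → ι) :
    AlternatesBy P Q w ↔ StepsBy (fun i a b => if Even i then P a b else Q a b) w :=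
  ⟨fun H i h => H ⟨i, by omega⟩ h, fun H i h => H i h⟩

lemma stepsBy_congr {rel rel' : ℕ → ι → ι → Prop}
    (h : ∀ i, i + 1 < n → ∀ a b, rel i a b ↔ rel' i a b) (w : Fin n → ι) :
    StepsBy rel w ↔ StepsBy rel' w :=
  forall_congr' fun i => forall_congr' fun hi => h i hi _ _

lemma content_append {m : ℕ} (u : Fin m → ι) (v : Fin n → ι) :
    content (Fin.append u v) = content u + content v := by
  simp [content, Fin.sum_univ_add]

/-- The hypothesis `h₀` leaves the step across the junction unconstrained, so the conditions on the
two factors are independent. -/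
lemma stepsBy_append {m : ℕ} {rel rel₁ rel₂ : ℕ → ι → ι → Prop} (u : Fin m → ι) (v : Fin n → ι)
    (h₁ : ∀ i, i + 1 < m → rel i = rel₁ i) (h₂ : ∀ i, rel (m + i) = rel₂ i)
    (h₀ : ∀ i, i + 1 = m → ∀ a b, rel i a b) :
    StepsBy rel (Fin.append u v) ↔ StepsBy rel₁ u ∧ StepsBy rel₂ v := by
  have hu : ∀ (i : ℕ) (h : i < m) (h' : i < m + n), Fin.append u v ⟨i, h'⟩ = u ⟨i, h⟩ :=
    fun i h h' => Fin.append_left u v ⟨i, h⟩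
  have hv : ∀ (i : ℕ) (h : i < n) (h' : m + i < m + n), Fin.append u v ⟨m + i, h'⟩ = v ⟨i, h⟩ :=
    fun i h h' => Fin.append_right u v ⟨i, h⟩
  constructor
  · refine fun H => ⟨fun i hi => ?_, fun i hi => ?_⟩
    · have := H i (by omega)
      rwa [hu i (by omega), hu (i + 1) hi, h₁ i hi] at this
    · have := H (m + i) (by omega)
      rwa [hv i (by omega), h₂, show (⟨m + i + 1, by omega⟩ : Fin (m + n)) = ⟨m + (i + 1), by omega⟩
        from rfl, hv (i + 1) hi] at this
  · rintro ⟨H₁, H₂⟩ i hi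
    rcases lt_trichotomy (i + 1) m with h | h | h
    · rw [hu i (by omega), hu (i + 1) h, h₁ i h]
      exact H₁ i h
    · exact h₀ i h _ _
    · obtain ⟨j, rfl⟩ := Nat.exists_eq_add_of_le (show m ≤ i by omega)
      have := H₂ j (by omega)
      rwa [h₂, hv j (by omega), show (⟨m + j + 1, hi⟩ : Fin (m + n)) = ⟨m + (j + 1), hi⟩ from rfl,
        hv (j + 1) (by omega)]

variable [Fintype ι]

open Classical in
/-- The sum of the monomials of the words of length `n` with a given property. -/
noncomputable def wordSum (R : Type*) [CommRing R] (P : (Fin n → ι) → Prop) : MvPowerSeries ι R :=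
  ∑ w with P w, MvPowerSeries.monomial (content w) 1

variable {R : Type*} [CommRing R]

open Classical in
lemma coeff_wordSum (P : (Fin n → ι) → Prop) (d : ι →₀ ℕ) :
    MvPowerSeries.coeff d (wordSum R P) =
      (Nat.card {w : Fin n → ι // content w = d ∧ P w} : R) := by
  rw [wordSum, map_sum, Nat.card_eq_fintype_card, Fintype.card_subtype, Finset.card_filter,
    Finset.sum_filter]
  push_cast
  refine Finset.sum_congr rfl fun w _ => ?_
  rw [MvPowerSeries.coeff_monomial]
  by_cases h : P w <;> by_cases h' : content w = d <;> simp [h, h', Ne.symm]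

lemma coeff_wordSum_of_degree_ne (P : (Fin n → ι) → Prop) {d : ι →₀ ℕ} (h : d.degree ≠ n) :
    MvPowerSeries.coeff d (wordSum R P) = 0 := by
  rw [coeff_wordSum]
  have : IsEmpty {w : Fin n → ι // content w = d ∧ P w} :=
    ⟨fun w => h (w.2.1 ▸ degree_content _)⟩
  simp

lemma wordSum_congr {P Q : (Fin n → ι) → Prop} (h : ∀ w, P w ↔ Q w) :
    wordSum R P = wordSum R Q := by
  rw [funext fun w => propext (h w)]

lemma wordSum_eq_add {P Q S : (Fin n → ι) → Prop} (h : ∀ w, P w ↔ Q w ∨ S w)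
    (hd : ∀ w, Q w → ¬ S w) : wordSum R P = wordSum R Q + wordSum R S := by
  classical
  rw [wordSum, wordSum, wordSum, ← Finset.sum_union]
  · refine Finset.sum_congr ?_ fun _ _ => rfl
    ext w
    simp [h]
  · rw [Finset.disjoint_left]
    intro w hw hw'
    exact hd w (Finset.mem_filter.mp hw).2 (Finset.mem_filter.mp hw').2

lemma wordSum_mul {m : ℕ} {P : (Fin m → ι) → Prop} {Q : (Fin n → ι) → Prop}
    {S : (Fin (m + n) → ι) → Prop} (h : ∀ u v, S (Fin.append u v) ↔ P u ∧ Q v) :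
    wordSum R P * wordSum R Q = wordSum R S := by
  classical
  rw [wordSum, wordSum, wordSum, Finset.sum_mul_sum, ← Finset.sum_product']
  refine Finset.sum_bij' (fun p _ => Fin.appendEquiv m n p)
    (fun w _ => (Fin.appendEquiv m n).symm w) ?_ ?_ ?_ ?_ ?_
  · rintro ⟨u, v⟩ hp
    simpa [Fin.appendEquiv, h] using hp
  · intro w hw
    obtain ⟨⟨u, v⟩, rfl⟩ := (Fin.appendEquiv m n).surjective w
    rw [Equiv.symm_apply_apply]
    simpa [Fin.appendEquiv, h] using hw
  · intro p _
    simp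
  · intro w _
    exact (Fin.appendEquiv m n).apply_symm_apply w
  · rintro ⟨u, v⟩ _
    simp [Fin.appendEquiv, content_append, MvPowerSeries.monomial_mul_monomial]

end Words

/-! ### Chains and alternating words -/

section Alternating

variable {ι : Type*} {R : Type*} [CommRing R] {P Q : ι → ι → Prop}

/-- The first `2 * l` letters form a chain, and the word alternates from there on. -/
def chainThenAlt (P Q : ι → ι → Prop) (l i : ℕ) (a b : ι) : Prop :=
  if i + 1 < 2 * l ∨ Even i then P a b else Q a b

/-- As `chainThenAlt`, without a condition at the end of the chain. -/
def chainFreeAlt (P Q : ι → ι → Prop) (l i : ℕ) (a b : ι) : Prop :=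
  if i + 1 = 2 * l then True else chainThenAlt P Q l i a b

lemma chainFreeAlt_zero (P Q : ι → ι → Prop) : chainFreeAlt P Q 0 = chainThenAlt P Q 1 := by
  funext i a b
  rcases i with _ | i
  · simp [chainFreeAlt, chainThenAlt]
  · simp [chainFreeAlt, chainThenAlt]

lemma coeff_neg_one_pow_mul (l : ℕ) (f : MvPowerSeries ι R) (d : ι →₀ ℕ) :
    MvPowerSeries.coeff d ((-1) ^ l * f) = (-1) ^ l * MvPowerSeries.coeff d f := by
  rcases neg_one_pow_eq_or (MvPowerSeries ι R) l with h | h <;>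
  rcases Nat.even_or_odd l with h' | h' <;> simp [h'.neg_one_pow]

variable [Fintype ι]

lemma wordSum_chain_mul_alt {l m n : ℕ} (h : 2 * l + m = n) :
    wordSum R (n := 2 * l) (StepsBy fun _ => P) * wordSum R (n := m) (AlternatesBy P Q) =
      wordSum R (n := n) (StepsBy (chainFreeAlt P Q l)) := by
  subst h
  refine wordSum_mul fun u v => ?_
  rw [alternatesBy_iff_stepsBy]
  refine stepsBy_append u v (fun i hi => ?_) (fun i => ?_) (fun i hi a b => ?_)
  · funext a b
    simp [chainFreeAlt, chainThenAlt, hi, hi.ne]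
  · funext a b
    have h1 : ¬ (2 * l + i + 1 = 2 * l) := by omega
    have h2 : ¬ (2 * l + i + 1 < 2 * l) := by omega
    simp [chainFreeAlt, chainThenAlt, h1, h2, Nat.even_add]
  · simp [chainFreeAlt, hi]

/-- The unconstrained step has odd index 2l - 1 and satisfies exactly one of `Q` and `P`. With `Q`
the chain stops there; with `P` it grows by two letters, since the next step, if there is one, has
even index and is a `P` step anyway. -/
lemma wordSum_chainFreeAlt (hPQ : ∀ a b, Q a b ↔ ¬ P a b) {l n : ℕ} (hl : 1 ≤ l)
    (h : 2 * l < n) :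
    wordSum R (n := n) (StepsBy (chainFreeAlt P Q l)) =
      wordSum R (n := n) (StepsBy (chainThenAlt P Q l)) +
        wordSum R (n := n) (StepsBy (chainThenAlt P Q (l + 1))) := by
  have hodd : ¬ Even (2 * l - 1) := by
    rw [Nat.not_even_iff_odd]
    exact ⟨l - 1, by omega⟩
  have key : ∀ i, i ≠ 2 * l - 1 → ∀ a b,
      (chainFreeAlt P Q l i a b ↔ chainThenAlt P Q l i a b) ∧
      (chainFreeAlt P Q l i a b ↔ chainThenAlt P Q (l + 1) i a b) := by
    intro i hi a b
    have h1 : i + 1 ≠ 2 * l := by omega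
    have h2 : (i + 1 < 2 * (l + 1) ∨ Even i) ↔ (i + 1 < 2 * l ∨ Even i) := by
      by_cases he : Even i
      · simp [he]
      · obtain ⟨j, rfl⟩ := Nat.not_even_iff_odd.mp he
        constructor <;> rintro (h | h) <;> first | exact Or.inr h | (left; omega)
    simp only [chainFreeAlt, chainThenAlt, h1, h2, if_false, and_self]
  have h1 : ∀ a b, chainThenAlt P Q l (2 * l - 1) a b ↔ Q a b := fun a b => by
    rw [chainThenAlt, if_neg]
    rintro (h | h)
    · omega
    · exact hodd h
  have h2 : ∀ a b, chainThenAlt P Q (l + 1) (2 * l - 1) a b ↔ P a b := fun a b => by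
    rw [chainThenAlt, if_pos (Or.inl (by omega))]
  refine wordSum_eq_add (fun w => ⟨fun H => ?_, ?_⟩) fun w H H' => ?_
  · by_cases hP : P (w ⟨2 * l - 1, by omega⟩) (w ⟨2 * l - 1 + 1, by omega⟩)
    · refine Or.inr fun i hi => ?_
      by_cases h : i = 2 * l - 1
      · subst h
        exact (h2 _ _).mpr hP
      · exact (key i h _ _).2.mp (H i hi)
    · refine Or.inl fun i hi => ?_
      by_cases h : i = 2 * l - 1
      · subst h
        exact (h1 _ _).mpr ((hPQ _ _).mpr hP)
      · exact (key i h _ _).1.mp (H i hi)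
  · rintro (H | H) i hi
    all_goals
      by_cases h : i = 2 * l - 1
      · rw [chainFreeAlt, if_pos (by omega)]
        trivial
    · exact (key i h _ _).1.mpr (H i hi)
    · exact (key i h _ _).2.mpr (H i hi)
  · exact (hPQ _ _).mp ((h1 _ _).mp (H (2 * l - 1) (by omega)))
      ((h2 _ _).mp (H' (2 * l - 1) (by omega)))

/-- By `wordSum_chainFreeAlt` each product is a sum of two consecutive terms, so the alternating sum
telescopes. -/
lemma sum_wordSum_chain_mul_alt (hPQ : ∀ a b, Q a b ↔ ¬ P a b) {L n : ℕ} (h : 2 * L < n) :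
    ∑ l ∈ Finset.range (L + 1), (-1 : MvPowerSeries ι R) ^ l *
      (wordSum R (n := 2 * l) (StepsBy fun _ => P) *
        wordSum R (n := n - 2 * l) (AlternatesBy P Q)) =
      (-1) ^ L * wordSum R (n := n) (StepsBy (chainThenAlt P Q (L + 1))) := by
  induction L with
  | zero => simp [← chainFreeAlt_zero, wordSum_chain_mul_alt (l := 0) (Nat.zero_add n)]
  | succ L ih =>
    rw [Finset.sum_range_succ, ih (by omega), wordSum_chain_mul_alt (n := n) (by omega),
      wordSum_chainFreeAlt hPQ (by omega) h]
    ring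

lemma wordSum_chainThenAlt {l n : ℕ} (h : n ≤ 2 * l) :
    wordSum R (n := n) (StepsBy (chainThenAlt P Q l)) =
      wordSum R (n := n) (StepsBy fun _ => P) := by
  refine wordSum_congr (stepsBy_congr fun i hi a b => ?_)
  rw [chainThenAlt, if_pos (Or.inl (by omega))]

lemma wordSum_stepsBy_of_eq_zero {n : ℕ} (hn : n = 0) (rel : ℕ → ι → ι → Prop) :
    wordSum R (n := n) (StepsBy rel) = 1 := by
  classical
  subst hn
  have h : ∀ w : Fin 0 → ι, StepsBy rel w := fun w i hi => by omega
  simp [wordSum, h, content, MvPowerSeries.monomial_zero_one]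

lemma sum_wordSum_of_odd (hPQ : ∀ a b, Q a b ↔ ¬ P a b) (M : ℕ) :
    ∑ l ∈ Finset.range (M + 1), (-1 : MvPowerSeries ι R) ^ l *
      (wordSum R (n := 2 * l) (StepsBy fun _ => P) *
        wordSum R (n := 2 * M + 1 - 2 * l) (AlternatesBy P Q)) =
      (-1) ^ M * wordSum R (n := 2 * M + 1) (StepsBy fun _ => P) := by
  rw [sum_wordSum_chain_mul_alt hPQ (by omega), wordSum_chainThenAlt (by omega)]

lemma sum_wordSum_of_even (hPQ : ∀ a b, Q a b ↔ ¬ P a b) {M : ℕ} (hM : 1 ≤ M) :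
    ∑ l ∈ Finset.range (M + 1), (-1 : MvPowerSeries ι R) ^ l *
      (wordSum R (n := 2 * l) (StepsBy fun _ => P) *
        wordSum R (n := 2 * M - 2 * l) (AlternatesBy P Q)) = 0 := by
  obtain ⟨L, rfl⟩ := Nat.exists_eq_add_of_le' hM
  -- The last summand has an empty alternating factor, so it is not covered by the telescoping. It
  -- is the series of chains of full length and cancels the telescoped remainder.
  rw [Finset.sum_range_succ, sum_wordSum_chain_mul_alt hPQ (by omega),
    wordSum_chain_mul_alt (n := 2 * (L + 1)) (by omega), wordSum_chainThenAlt (by omega),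
    wordSum_congr (R := R) (n := 2 * (L + 1)) (P := StepsBy (chainFreeAlt P Q (L + 1))) (Q := StepsBy fun _ => P)]
  · ring
  · refine stepsBy_congr fun i hi a b => ?_
    rw [chainFreeAlt, if_neg (by omega), chainThenAlt, if_pos (Or.inl (by omega))]

/-- The generating function of the words whose letters are consecutively related by `P`. -/
noncomputable def chainSeries (R : Type*) [CommRing R] (P : ι → ι → Prop) : MvPowerSeries ι R :=
  fun d => MvPowerSeries.coeff d (wordSum R (n := d.degree) (StepsBy fun _ => P))

/-- The generating function of the words with `P a₁ a₂`, `Q a₂ a₃`, `P a₃ a₄`, …. -/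
noncomputable def altSeries (R : Type*) [CommRing R] (P Q : ι → ι → Prop) : MvPowerSeries ι R :=
  fun d => MvPowerSeries.coeff d (wordSum R (n := d.degree) (AlternatesBy P Q))

open Classical in
/-- The even part of the series of chains, with alternating signs. -/
noncomputable def chainCos (R : Type*) [CommRing R] (P : ι → ι → Prop) : MvPowerSeries ι R :=
  fun d => if Even d.degree then
    (-1) ^ (d.degree / 2) * MvPowerSeries.coeff d (chainSeries R P) else 0

open Classical in
/-- The odd part of the series of chains, with alternating signs. -/
noncomputable def chainSin (R : Type*) [CommRing R] (P : ι → ι → Prop) : MvPowerSeries ι R :=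
  fun d => if Even d.degree then 0 else
    (-1) ^ (d.degree / 2) * MvPowerSeries.coeff d (chainSeries R P)

lemma coeff_chainSeries (d : ι →₀ ℕ) : MvPowerSeries.coeff d (chainSeries R P) =
    MvPowerSeries.coeff d (wordSum R (n := d.degree) (StepsBy fun _ => P)) := rfl

lemma coeff_altSeries (d : ι →₀ ℕ) : MvPowerSeries.coeff d (altSeries R P Q) =
    MvPowerSeries.coeff d (wordSum R (n := d.degree) (AlternatesBy P Q)) := rfl

lemma coeff_chainCos_mul_altSeries (d : ι →₀ ℕ) :
    MvPowerSeries.coeff d (chainCos R P * altSeries R P Q) =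
      MvPowerSeries.coeff d (∑ l ∈ Finset.range (d.degree / 2 + 1),
        (-1 : MvPowerSeries ι R) ^ l * (wordSum R (n := 2 * l) (StepsBy fun _ => P) *
          wordSum R (n := d.degree - 2 * l) (AlternatesBy P Q))) := by
  classical
  simp only [map_sum, coeff_neg_one_pow_mul]
  simp only [MvPowerSeries.coeff_mul, Finset.mul_sum]
  rw [Finset.sum_comm]
  refine Finset.sum_congr rfl fun p hp => ?_
  rw [mem_antidiagonal] at hp
  have hdeg : p.1.degree + p.2.degree = d.degree := by rw [← hp, map_add]
  by_cases he : Even p.1.degree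
  · obtain ⟨l, hl⟩ := he.two_dvd
    -- Words of length 2l only contribute to degree 2l, so one l survives for each splitting of d.
    rw [Finset.sum_eq_single l]
    · have h2 : d.degree - 2 * l = p.2.degree := by omega
      have h3 : MvPowerSeries.coeff p.1 (chainCos R P) =
          (-1) ^ l * MvPowerSeries.coeff p.1 (wordSum R (n := 2 * l) (StepsBy fun _ => P)) := by
        have : MvPowerSeries.coeff p.1 (chainCos R P) = (-1) ^ (p.1.degree / 2) *
            MvPowerSeries.coeff p.1 (wordSum R (n := p.1.degree) (StepsBy fun _ => P)) :=
          if_pos he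
        rw [this, hl, Nat.mul_div_cancel_left l two_pos]
      rw [h3, coeff_altSeries, h2, mul_assoc]
    · intro l' _ hne
      rw [coeff_wordSum_of_degree_ne, zero_mul, mul_zero]
      omega
    · intro h
      exact absurd (Finset.mem_range.mpr (by omega)) h
  · have h3 : MvPowerSeries.coeff p.1 (chainCos R P) = 0 := if_neg he
    rw [h3, zero_mul, Finset.sum_eq_zero]
    intro l _
    rw [coeff_wordSum_of_degree_ne, zero_mul, mul_zero]
    rintro h
    exact he (h ▸ even_two_mul l)

lemma chainCos_mul_altSeries (hPQ : ∀ a b, Q a b ↔ ¬ P a b) :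
    chainCos R P * altSeries R P Q = 1 + chainSin R P := by
  classical
  ext d
  rw [coeff_chainCos_mul_altSeries, map_add, MvPowerSeries.coeff_one]
  rcases Nat.even_or_odd' d.degree with ⟨M, hM | hM⟩
  · have h0 : MvPowerSeries.coeff d (chainSin R P) = 0 := if_pos (hM ▸ even_two_mul M)
    rw [h0, add_zero]
    rcases Nat.eq_zero_or_pos M with rfl | hpos
    · have hd : d = 0 := by simpa [Finsupp.degree_eq_zero_iff] using hM
      subst hd
      simp only [map_zero, Nat.zero_div, zero_add, Finset.range_one, Finset.sum_singleton,
        pow_zero, one_mul]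
      rw [wordSum_chain_mul_alt (l := 0) rfl, wordSum_stepsBy_of_eq_zero (by simp)]
      simp
    · have hd : d ≠ 0 := by
        rintro rfl
        simp at hM
        omega
      rw [hM, Nat.mul_div_cancel_left M two_pos, sum_wordSum_of_even hPQ hpos, map_zero, if_neg hd]
  · have hodd : ¬ Even d.degree := by
      rw [Nat.not_even_iff_odd]
      exact ⟨M, hM⟩
    have h0 : MvPowerSeries.coeff d (chainSin R P) = (-1) ^ (d.degree / 2) *
            MvPowerSeries.coeff d (wordSum R (n := d.degree) (StepsBy fun _ => P)) := if_neg hodd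
    have hd : d ≠ 0 := by
      rintro rfl
      simp at hodd
    rw [h0, if_neg hd, zero_add, hM, show (2 * M + 1) / 2 = M by omega, sum_wordSum_of_odd hPQ,
      coeff_neg_one_pow_mul]

end Alternating

/-! ### Counting chains -/

section Chains

variable {ι : Type*} {n : ℕ}

lemma toMultiset_content (w : Fin n → ι) : Finsupp.toMultiset (content w) = List.ofFn w := by
  rw [content, map_sum, ← Fin.univ_val_map]
  simp only [Finsupp.toMultiset_single, one_smul]
  exact (congrArg Multiset.sum (Multiset.map_map (fun a => ({a} : Multiset ι)) w _)).symm.trans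
    (Multiset.sum_map_singleton _)

lemma content_eq_iff (w : Fin n → ι) (d : ι →₀ ℕ) :
    content w = d ↔ (List.ofFn w : Multiset ι) = Finsupp.toMultiset d := by
  classical
  rw [← toMultiset_content]
  exact ⟨congrArg _, fun h => by simpa using congrArg Multiset.toFinsupp h⟩

/-- A multiset has only one sorted listing. -/
lemma eq_of_monotone_of_content_eq [LinearOrder ι] {v w : Fin n → ι} (hv : Monotone v)
    (hw : Monotone w) (h : content v = content w) : v = w := by
  rw [content_eq_iff, toMultiset_content, Multiset.coe_eq_coe] at h
  exact List.ofFn_injective (h.eq_of_sortedLE hv.sortedLE_ofFn hw.sortedLE_ofFn)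

lemma exists_monotone_content_eq [LinearOrder ι] (d : ι →₀ ℕ) :
    ∃ w : Fin d.degree → ι, Monotone w ∧ content w = d := by
  set l := (Finsupp.toMultiset d).sort (· ≤ ·) with hl
  have hlen : d.degree = l.length := by
    rw [hl, Multiset.length_sort, Finsupp.card_toMultiset]
    rfl
  refine ⟨fun i => l.get (Fin.cast hlen i), ?_, ?_⟩
  · have h : l.SortedLE := (Multiset.pairwise_sort _ _).sortedLE
    exact fun i j hij => h.monotone_get (by simpa using hij)
  · rw [content_eq_iff]
    have : List.ofFn (fun i => l.get (Fin.cast hlen i)) = l := by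
      refine List.ext_get (by simp [hlen]) fun k h1 h2 => by simp
    rw [this, hl, Multiset.sort_eq]

lemma monotone_of_stepsBy [LinearOrder ι] {P : ι → ι → Prop} (hP : ∀ a b, P a b → a ≤ b)
    {w : Fin n → ι} (hw : StepsBy (fun _ => P) w) : Monotone w := by
  cases n with
  | zero => exact fun i => i.elim0
  | succ n =>
    rw [Fin.monotone_iff_le_succ]
    exact fun i => hP _ _ (hw i (by omega))

lemma two_le_content {w : Fin n → ι} {i i' : Fin n} (h : i ≠ i') (hw : w i = w i') :
    2 ≤ content w (w i) := by
  classical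
  rw [content_apply]
  exact Finset.one_lt_card.mpr ⟨i, by simp, i', by simp [hw], h⟩

-- A chain is the weakly increasing word of its content, and it exists precisely when every repeated
-- letter belongs to `B`.
open Classical in
lemma coeff_chainSeries_of_linearOrder [Fintype ι] [LinearOrder ι] {R : Type*} [CommRing R]
    (B : Finset ι) {P : ι → ι → Prop} (hP : ∀ a b, P a b ↔ a < b ∨ (a = b ∧ a ∈ B))
    (d : ι →₀ ℕ) :
    MvPowerSeries.coeff d (chainSeries R P) = ∏ j, if j ∈ B ∨ d j ≤ 1 then (1 : R) else 0 := by
  have hle : ∀ a b, P a b → a ≤ b := fun a b h => by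
    rcases (hP a b).mp h with h | h
    exacts [h.le, h.1.le]
  rw [Finset.prod_ite_zero, coeff_chainSeries, coeff_wordSum]
  simp only [Finset.mem_univ, forall_true_left, Finset.prod_const_one]
  split_ifs with hd
  · obtain ⟨w, hw, hwd⟩ := exists_monotone_content_eq d
    rw [Nat.card_eq_one_iff_unique.mpr, Nat.cast_one]
    refine ⟨⟨fun u v => Subtype.ext (eq_of_monotone_of_content_eq (monotone_of_stepsBy hle u.2.2)
      (monotone_of_stepsBy hle v.2.2) (u.2.1.trans v.2.1.symm))⟩, ⟨w, hwd, fun i hi => ?_⟩⟩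
    refine (hP _ _).mpr ?_
    rcases (hw (show (⟨i, by omega⟩ : Fin d.degree) ≤ ⟨i + 1, hi⟩ by simp)).lt_or_eq with h | h
    · exact Or.inl h
    · refine Or.inr ⟨h, ?_⟩
      have := two_le_content (i := ⟨i, by omega⟩) (i' := ⟨i + 1, hi⟩) (by simp) h
      rw [hwd] at this
      exact (hd _).resolve_right (by omega)
  · push Not at hd
    obtain ⟨j, hjB, hj⟩ := hd
    rw [Nat.card_eq_zero.mpr, Nat.cast_zero]
    refine Or.inl ⟨fun ⟨w, hwd, hw⟩ => ?_⟩
    rw [← hwd, content_apply, Finset.one_lt_card] at hj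
    obtain ⟨a, ha, b, hb, hab⟩ := hj
    wlog hlt : a < b generalizing a b
    · exact this b hb a ha hab.symm (lt_of_le_of_ne (not_lt.mp hlt) hab.symm)
    simp only [Finset.mem_filter, Finset.mem_univ, true_and] at ha hb
    have hmono := monotone_of_stepsBy hle hw
    have h1 : (a : ℕ) + 1 < d.degree := by
      have := Fin.lt_def.mp hlt
      omega
    -- Monotonicity squeezes the letter after position `a` between two equal letters, so the
    -- repetition occurs at adjacent positions.
    have h2 : w a ≤ w ⟨a + 1, h1⟩ := hmono (by simp [Fin.le_def])
    have h3 : w ⟨a + 1, h1⟩ ≤ w b := hmono (by simpa [Fin.le_def] using hlt)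
    rcases (hP _ _).mp (hw a h1) with h | h
    · exact absurd h (not_lt.mpr (h3.trans_eq (hb.trans ha.symm)))
    · exact hjB (ha ▸ h.2)

end Chains

/-! ### Sequences `c, b, -c, -b, …` -/

section Periodic

variable {R : Type*} [CommRing R]

/-- The sequence `c, b, -c, -b, c, b, -c, -b, …`. -/
def altPeriodic (c b : R) : ℕ → R
  | 0 => c
  | 1 => b
  | i + 2 => -altPeriodic c b i

lemma eq_altPeriodic {c b : R} {f : ℕ → R} (h0 : f 0 = c) (h1 : f 1 = b)
    (h : ∀ i, f (i + 2) = -f i) : f = altPeriodic c b := by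
  funext i
  induction i using Nat.twoStepInduction with
  | zero => exact h0
  | one => exact h1
  | more i ih _ => rw [h, ih]; rfl

lemma altPeriodic_add_two (c b : R) (i : ℕ) :
    altPeriodic c b (i + 2) = -altPeriodic c b i := rfl

lemma altPeriodic_add (c b c' b' : R) :
    altPeriodic c b + altPeriodic c' b' = altPeriodic (c + c') (b + b') :=
  eq_altPeriodic rfl rfl fun i => by simp only [Pi.add_apply, altPeriodic_add_two]; ring

lemma map_altPeriodic {S : Type*} [CommRing S] (φ : R →+* S) (c b : R) :
    (fun i => φ (altPeriodic c b i)) = altPeriodic (φ c) (φ b) :=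
  eq_altPeriodic rfl rfl fun i => by simp only [altPeriodic_add_two, map_neg]

lemma neg_one_pow_mul_altPeriodic (c b : R) :
    (fun i => (-1) ^ i * altPeriodic c b i) = altPeriodic c (-b) :=
  eq_altPeriodic (by simp [altPeriodic]) (by simp [altPeriodic]) fun i => by
    simp only [altPeriodic_add_two]; ring

lemma neg_one_pow_succ_mul_altPeriodic (c b : R) :
    (fun i => (-1) ^ (i + 1) * altPeriodic c b i) = altPeriodic (-c) b :=
  eq_altPeriodic (by simp [altPeriodic]) (by simp [altPeriodic]) fun i => by
    simp only [altPeriodic_add_two]; ring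

lemma periodicSeq_eq_altPeriodic (c b : ℚ[X]) :
    periodicSeq c b (-c) (-b) = altPeriodic c b := by
  refine eq_altPeriodic rfl rfl fun i => ?_
  have h : ∀ j : Fin 4, (![c, b, -c, -b] : Fin 4 → ℚ[X]) (j + 2) = -![c, b, -c, -b] j := by
    intro j
    fin_cases j <;> simp
  have h2 : Fin.ofNat 4 (i + 2) = Fin.ofNat 4 i + 2 := by
    ext
    simp [Fin.val_add]
  rw [periodicSeq, periodicSeq, h2, h]

end Periodic

/-! ### Exponentials of arctangents and logarithms -/

section PeriodicNewton

variable {R : Type*} [CommRing R] [Algebra ℚ R]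

lemma newton_altPeriodic_neg (c b : R) (m : ℕ) :
    newton (altPeriodic (-c) b) m = (-1) ^ m * newton (altPeriodic c b) m := by
  rw [← neg_one_pow_succ_mul_altPeriodic, newton_pow_mul]

lemma newton_altPeriodic_zero (m : ℕ) : newton (altPeriodic (0 : R) 0) m = 0 ^ m := by
  rw [← newton_geometric]
  congr 1
  exact (eq_altPeriodic (by simp) (by simp) fun i => by simp).symm

-- Here 1/(1 - Ix) = exp(I arctan x - ½ log(1 + x²)).
open Complex in
lemma newton_altPeriodic_I_neg_one (m : ℕ) : newton (altPeriodic I (-1)) m = I ^ m := by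
  rw [← newton_geometric]
  congr 1
  refine (eq_altPeriodic (by simp) (by simp) fun i => ?_).symm
  rw [show i + 2 + 1 = (i + 1) + 2 by ring, pow_add, I_sq]
  ring

-- Here 1 + Ix = exp(I arctan x + ½ log(1 + x²)).
open Complex in
lemma newton_altPeriodic_I_one (m : ℕ) :
    newton (altPeriodic I 1) m = I ^ m * if m ≤ 1 then 1 else 0 := by
  rw [← newton_alternating_one, ← newton_pow_mul]
  congr 1
  refine (eq_altPeriodic (by simp) (by simp) fun i => ?_).symm
  rw [show i + 2 + 1 = (i + 1) + 2 by ring, pow_add I, I_sq]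
  ring

/-- The product over `j` of the series `exp (c arctan xⱼ + b j log (1 + xⱼ ^ 2) / 2)`. -/
noncomputable def arctanProd {ι : Type*} [Fintype ι] (c : R) (b : ι → R) : MvPowerSeries ι R :=
  newtonProd fun j => altPeriodic c (b j)

variable {ι : Type*} [Fintype ι]

lemma coeff_arctanProd (c : R) (b : ι → R) (d : ι →₀ ℕ) :
    MvPowerSeries.coeff d (arctanProd c b) = ∏ j, newton (altPeriodic c (b j)) (d j) := rfl

lemma arctanProd_mul (c c' : R) (b b' : ι → R) :
    arctanProd c b * arctanProd c' b' = arctanProd (c + c') (b + b') := by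
  rw [arctanProd, arctanProd, newtonProd_mul, arctanProd]
  congr 1
  funext j
  exact altPeriodic_add _ _ _ _

lemma map_coeff_arctanProd {S : Type*} [CommRing S] [Algebra ℚ S] (φ : R →+* S) (c : R)
    (b : ι → R) (d : ι →₀ ℕ) : φ (MvPowerSeries.coeff d (arctanProd c b)) =
      MvPowerSeries.coeff d (arctanProd (φ c) fun j => φ (b j)) := by
  simp only [coeff_arctanProd, map_prod, map_newton, map_altPeriodic]

lemma coeff_arctanProd_neg (c : R) (b : ι → R) (d : ι →₀ ℕ) :
    MvPowerSeries.coeff d (arctanProd (-c) b) =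
      (-1) ^ d.degree * MvPowerSeries.coeff d (arctanProd c b) := by
  simp only [coeff_arctanProd, newton_altPeriodic_neg, Finset.prod_mul_distrib,
    Finset.prod_pow_eq_pow_sum, Finsupp.degree_eq_sum]

lemma arctanProd_zero : arctanProd (0 : R) (0 : ι → R) = 1 := by
  classical
  ext d
  simp only [coeff_arctanProd, Pi.zero_apply, newton_altPeriodic_zero, MvPowerSeries.coeff_one]
  rw [Finset.prod_pow_eq_pow_sum, ← Finsupp.degree_eq_sum, zero_pow_eq]
  simp only [Finsupp.degree_eq_zero_iff]

end PeriodicNewton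

/-! ### The umbral functional -/

section Umbral

open Complex

/-- The values `n! [xⁿ] (sec x + tan x)`. -/
noncomputable def secTan (m : ℕ) : ℂ :=
  (0 ^ m + (I ^ m - (-I) ^ m) / (2 * I)) -
    ∑ j : Fin m, (I ^ (m - j : ℕ) + (-I) ^ (m - j : ℕ)) / 2 * m.choose j * secTan j

/-- This is cos x · (sec x + tan x) = 1 + sin x, compared at x^m / m!. -/
lemma sum_secTan (m : ℕ) : ∑ j ∈ Finset.range (m + 1),
    (I ^ (m - j) + (-I) ^ (m - j)) / 2 * m.choose j * secTan j =
      0 ^ m + (I ^ m - (-I) ^ m) / (2 * I) := by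
  rw [Finset.sum_range_succ, Finset.sum_range fun j =>
    (I ^ (m - j) + (-I) ^ (m - j)) / 2 * m.choose j * secTan j]
  have h : secTan m = (0 ^ m + (I ^ m - (-I) ^ m) / (2 * I)) -
      ∑ j : Fin m, (I ^ (m - j : ℕ) + (-I) ^ (m - j : ℕ)) / 2 * m.choose j * secTan j := by
    conv_lhs => rw [secTan]
  simp [h]

/-- The linear functional on polynomials with `X ^ m ↦ secTan m`. -/
noncomputable def umbralMap : ℂ[X] →ₗ[ℂ] ℂ :=
  Polynomial.lsum fun m => secTan m • LinearMap.id

lemma umbralMap_apply (q : ℂ[X]) : umbralMap q = q.sum fun m c => c * secTan m := by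
  simp [umbralMap, Polynomial.lsum_apply, mul_comm]

lemma umbralMap_X_pow (m : ℕ) : umbralMap (X ^ m) = secTan m := by
  rw [umbralMap_apply, ← Polynomial.monomial_one_right_eq_X_pow,
    Polynomial.sum_monomial_index] <;> simp

lemma umbralMap_C_mul (c : ℂ) (q : ℂ[X]) : umbralMap (C c * q) = c * umbralMap q := by
  rw [← Polynomial.smul_eq_C_mul, map_smul, smul_eq_mul]

lemma umbralMap_shift_pow (c : ℂ) (m : ℕ) : umbralMap ((X + C c) ^ m) =
    ∑ j ∈ Finset.range (m + 1), c ^ (m - j) * m.choose j * secTan j := by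
  rw [add_pow, map_sum]
  refine Finset.sum_congr rfl fun j _ => ?_
  rw [← umbralMap_X_pow, ← umbralMap_C_mul]
  congr 1
  simp only [map_mul, map_pow, map_natCast]
  ring

/-- The same identity as a statement on polynomials: a shift of the umbral variable by ±I multiplies
e^{Ex} by e^{±Ix}, and the two shifts add up to 2 cos x. -/
lemma umbralMap_comp_add (q : ℂ[X]) :
    umbralMap (q.comp (X + C I)) + umbralMap (q.comp (X + C (-I))) =
      2 * (q.eval 0 + (q.eval I - q.eval (-I)) / (2 * I)) := by
  induction q using Polynomial.induction_on' with
  | add p q hp hq =>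
    simp only [Polynomial.add_comp, map_add, Polynomial.eval_add]
    linear_combination hp + hq
  | monomial m c =>
    have h := sum_secTan m
    simp only [Polynomial.monomial_comp, umbralMap_C_mul, umbralMap_shift_pow,
      Polynomial.eval_monomial]
    rw [← mul_add, ← Finset.sum_add_distrib]
    have h2 : ∑ j ∈ Finset.range (m + 1), (I ^ (m - j) * m.choose j * secTan j +
        (-I) ^ (m - j) * m.choose j * secTan j) =
        2 * (0 ^ m + (I ^ m - (-I) ^ m) / (2 * I)) := by
      rw [← h, Finset.mul_sum]
      refine Finset.sum_congr rfl fun j _ => ?_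
      ring
    rw [h2]
    ring

variable {ι : Type*} [Fintype ι]

/-- The umbral evaluation of the coefficients of `arctanProd X b`. -/
noncomputable def umbralSeries (b : ι → ℂ) : MvPowerSeries ι ℂ :=
  fun d => umbralMap (MvPowerSeries.coeff d (arctanProd X fun j => C (b j)))

lemma coeff_umbralSeries (b : ι → ℂ) (d : ι →₀ ℕ) : MvPowerSeries.coeff d (umbralSeries b) =
    umbralMap (MvPowerSeries.coeff d (arctanProd X fun j => C (b j))) := rfl

lemma coeff_arctanProd_mul_umbralSeries (c : ℂ) (b : ι → ℂ) (d : ι →₀ ℕ) :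
    MvPowerSeries.coeff d (arctanProd c (-b) * umbralSeries b) =
      umbralMap ((MvPowerSeries.coeff d (arctanProd (X : ℂ[X]) 0)).comp (X + C c)) := by
  classical
  have h : (MvPowerSeries.coeff d (arctanProd (X : ℂ[X]) (0 : ι → ℂ[X]))).comp (X + C c) =
      MvPowerSeries.coeff d (arctanProd (C c) (fun j => C (-b j)) *
        arctanProd X fun j => C (b j)) := by
    have := map_coeff_arctanProd (Polynomial.compRingHom (X + C c)) (X : ℂ[X]) (0 : ι → ℂ[X]) d
    rw [Polynomial.coe_compRingHom_apply] at this
    rw [this, arctanProd_mul]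
    congr 2
    · simp [add_comm]
    · funext j
      simp
  rw [h, MvPowerSeries.coeff_mul, MvPowerSeries.coeff_mul, map_sum]
  refine Finset.sum_congr rfl fun p _ => ?_
  rw [← map_coeff_arctanProd C, umbralMap_C_mul]
  rfl

/-- The imaginary part of `arctanProd I 0`. -/
noncomputable def sinArctan (ι : Type*) [Fintype ι] : MvPowerSeries ι ℂ :=
  (2 * I)⁻¹ • (arctanProd I 0 - arctanProd (-I) 0)

/-- The factors e^{-Λ} and e^{Λ} cancel, which leaves 2 cos θ · (sec θ + tan θ) = 2 (1 + sin θ). It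
is `umbralMap_comp_add` applied to each coefficient of e^{Xθ}. -/
lemma arctanProd_mul_umbralSeries (b : ι → ℂ) :
    (arctanProd I (-b) + arctanProd (-I) (-b)) * umbralSeries b =
      (2 : ℂ) • (1 + sinArctan ι) := by
  ext d
  rw [add_mul, map_add, coeff_arctanProd_mul_umbralSeries, coeff_arctanProd_mul_umbralSeries,
    umbralMap_comp_add]
  have h : ∀ c : ℂ, (MvPowerSeries.coeff d (arctanProd (X : ℂ[X]) (0 : ι → ℂ[X]))).eval c =
      MvPowerSeries.coeff d (arctanProd c (0 : ι → ℂ)) := by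
    intro c
    have := map_coeff_arctanProd (Polynomial.evalRingHom c) (X : ℂ[X]) (0 : ι → ℂ[X]) d
    rw [Polynomial.coe_evalRingHom] at this
    rw [this]
    congr 2
    · simp
    · funext j
      simp
  rw [h, h, h, arctanProd_zero, sinArctan]
  simp only [MvPowerSeries.coeff_smul, map_add, map_sub]
  ring

end Umbral

/-! ### Comparison of alternating words with the umbral series -/

section Comparison

open Complex

variable {ι : Type*}

open Classical in
/-- The part of a power series in degrees of a given parity. -/
noncomputable def parityPart (e : Prop) (f : MvPowerSeries ι ℂ) : MvPowerSeries ι ℂ :=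
  fun d => if Even d.degree ↔ e then MvPowerSeries.coeff d f else 0

open Classical in
lemma coeff_parityPart (e : Prop) (f : MvPowerSeries ι ℂ) (d : ι →₀ ℕ) :
    MvPowerSeries.coeff d (parityPart e f) =
      if Even d.degree ↔ e then MvPowerSeries.coeff d f else 0 := rfl

variable [Fintype ι]

lemma I_pow_of_even {n : ℕ} (h : Even n) : I ^ n = (-1) ^ (n / 2) := by
  obtain ⟨m, rfl⟩ := h.two_dvd
  rw [pow_mul, I_sq, Nat.mul_div_cancel_left m two_pos]

lemma I_pow_of_odd {n : ℕ} (h : ¬ Even n) : I ^ n = (-1) ^ (n / 2) * I := by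
  obtain ⟨m, rfl⟩ := Nat.not_even_iff_odd.mp h
  rw [pow_succ, pow_mul, I_sq, show (2 * m + 1) / 2 = m by omega]

variable {P Q : ι → ι → Prop} {b : ι → ℂ}

lemma chainCos_eq (hP : ∀ d, MvPowerSeries.coeff d (arctanProd I (-b)) =
      I ^ d.degree * MvPowerSeries.coeff d (chainSeries ℂ P)) :
    (2 : ℂ) • chainCos ℂ P = arctanProd I (-b) + arctanProd (-I) (-b) := by
  classical
  ext d
  have h : MvPowerSeries.coeff d (chainCos ℂ P) = if Even d.degree then
    (-1) ^ (d.degree / 2) * MvPowerSeries.coeff d (chainSeries ℂ P) else 0 := rfl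
  rw [MvPowerSeries.coeff_smul, map_add, coeff_arctanProd_neg, hP, h]
  split_ifs with he
  · rw [he.neg_one_pow, I_pow_of_even he]
    ring
  · rw [(Nat.not_even_iff_odd.mp he).neg_one_pow]
    simp

lemma chainSin_eq (hP : ∀ d, MvPowerSeries.coeff d (arctanProd I (-b)) =
      I ^ d.degree * MvPowerSeries.coeff d (chainSeries ℂ P)) :
    (2 * I) • chainSin ℂ P = arctanProd I (-b) - arctanProd (-I) (-b) := by
  classical
  ext d
  have h : MvPowerSeries.coeff d (chainSin ℂ P) = if Even d.degree then 0 else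
    (-1) ^ (d.degree / 2) * MvPowerSeries.coeff d (chainSeries ℂ P) := rfl
  rw [MvPowerSeries.coeff_smul, map_sub, coeff_arctanProd_neg, hP, h]
  split_ifs with he
  · rw [he.neg_one_pow]
    simp
  · rw [(Nat.not_even_iff_odd.mp he).neg_one_pow, I_pow_of_odd he]
    ring

lemma coeff_chainCos_of_odd {d : ι →₀ ℕ} (h : ¬ Even d.degree) :
    MvPowerSeries.coeff d (chainCos ℂ P) = 0 := by
  classical
  exact if_neg h

lemma chainCos_mul_parityPart (e : Prop) (f : MvPowerSeries ι ℂ) :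
    chainCos ℂ P * parityPart e f = parityPart e (chainCos ℂ P * f) := by
  classical
  ext d
  rw [coeff_parityPart, MvPowerSeries.coeff_mul, MvPowerSeries.coeff_mul]
  have key : ∀ p ∈ antidiagonal d, MvPowerSeries.coeff p.1 (chainCos ℂ P) *
      MvPowerSeries.coeff p.2 (parityPart e f) = if Even d.degree ↔ e then
        MvPowerSeries.coeff p.1 (chainCos ℂ P) * MvPowerSeries.coeff p.2 f else 0 := by
    intro p hp
    rw [coeff_parityPart]
    by_cases he : Even p.1.degree
    · have : Even d.degree ↔ Even p.2.degree := by
        rw [← mem_antidiagonal.mp hp, map_add, Nat.even_add]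
        simp [he]
      simp only [this, mul_ite, mul_zero]
    · simp [coeff_chainCos_of_odd he]
  rw [Finset.sum_congr rfl key]
  split_ifs <;> simp

/-- An even factor preserves parity, and power series over ℂ form a domain, so `chainCos` can be
cancelled within one parity class. -/
lemma coeff_eq_zero_of_chainCos_mul (hc : chainCos ℂ P ≠ 0) {e : Prop} {f : MvPowerSeries ι ℂ}
    (h : ∀ d : ι →₀ ℕ, (Even d.degree ↔ e) → MvPowerSeries.coeff d (chainCos ℂ P * f) = 0)
    {d : ι →₀ ℕ} (hd : Even d.degree ↔ e) : MvPowerSeries.coeff d f = 0 := by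
  classical
  have h0 : chainCos ℂ P * parityPart e f = 0 := by
    rw [chainCos_mul_parityPart]
    ext d
    rw [coeff_parityPart]
    split_ifs with h'
    · exact h d h'
    · simp
  have := congrArg (MvPowerSeries.coeff d) ((mul_eq_zero.mp h0).resolve_left hc)
  rwa [coeff_parityPart, if_pos hd, map_zero] at this

lemma coeff_chainSin_of_even {d : ι →₀ ℕ} (h : Even d.degree) :
    MvPowerSeries.coeff d (chainSin ℂ P) = 0 := by
  classical
  exact if_pos h

lemma chainCos_ne_zero (hPQ : ∀ a b, Q a b ↔ ¬ P a b) : chainCos ℂ P ≠ 0 := by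
  classical
  intro h
  have := congrArg (MvPowerSeries.coeff 0) (chainCos_mul_altSeries (R := ℂ) hPQ)
  have h0 : MvPowerSeries.coeff (0 : ι →₀ ℕ) (chainSin ℂ P) = 0 :=
    coeff_chainSin_of_even (by simp)
  rw [h, zero_mul, map_zero, map_add, h0] at this
  simp at this

lemma coeff_sinArctan_of_even {d : ι →₀ ℕ} (h : Even d.degree) :
    MvPowerSeries.coeff d (sinArctan ι) = 0 := by
  rw [sinArctan, MvPowerSeries.coeff_smul, map_sub, coeff_arctanProd_neg, h.neg_one_pow]
  simp

lemma coeff_altSeries_of_even (hPQ : ∀ a b, Q a b ↔ ¬ P a b)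
    (hP : ∀ d, MvPowerSeries.coeff d (arctanProd I (-b)) =
      I ^ d.degree * MvPowerSeries.coeff d (chainSeries ℂ P)) {d : ι →₀ ℕ} (hd : Even d.degree) :
    MvPowerSeries.coeff d (altSeries ℂ P Q) = MvPowerSeries.coeff d (umbralSeries b) := by
  have h1 : chainCos ℂ P * umbralSeries b = 1 + sinArctan ι := by
    have := arctanProd_mul_umbralSeries b
    rw [← chainCos_eq hP, smul_mul_assoc] at this
    exact smul_right_injective _ two_ne_zero this
  rw [← sub_eq_zero, ← map_sub]
  refine coeff_eq_zero_of_chainCos_mul (P := P) (e := True) (chainCos_ne_zero hPQ) ?_ (by simpa)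
  intro d hd
  rw [iff_true] at hd
  rw [mul_sub, h1, chainCos_mul_altSeries hPQ, add_sub_add_left_eq_sub, map_sub,
    coeff_sinArctan_of_even hd, coeff_chainSin_of_even hd, sub_zero]

lemma coeff_altSeries_of_odd (hPQ : ∀ a b, Q a b ↔ ¬ P a b)
    (hP : ∀ d, MvPowerSeries.coeff d (arctanProd I (-b)) =
      I ^ d.degree * MvPowerSeries.coeff d (chainSeries ℂ P)) {d : ι →₀ ℕ} (hd : Odd d.degree) :
    MvPowerSeries.coeff d (altSeries ℂ P Q) = MvPowerSeries.coeff d (umbralSeries 0) := by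
  have hr : ∀ c : ℂ, arctanProd c (-b) = arctanProd 0 (-b) * arctanProd c 0 := by
    intro c
    rw [arctanProd_mul, zero_add, add_zero]
  have h1 : chainCos ℂ P * umbralSeries 0 = arctanProd 0 (-b) + chainSin ℂ P := by
    have h := arctanProd_mul_umbralSeries (0 : ι → ℂ)
    rw [neg_zero] at h
    refine smul_right_injective _ (two_ne_zero (α := ℂ)) ?_
    have hs := chainSin_eq hP
    have hI : (2 * I)⁻¹ • ((2 * I) • chainSin ℂ P) = chainSin ℂ P := by
      rw [smul_smul, inv_mul_cancel₀ (by simp), one_smul]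
    dsimp only
    rw [← smul_mul_assoc, chainCos_eq hP, ← hI, hs, hr I, hr (-I), ← mul_add, mul_assoc, h,
      sinArctan, ← mul_sub]
    simp only [mul_smul_comm, mul_add, mul_one]
  rw [← sub_eq_zero, ← map_sub]
  refine coeff_eq_zero_of_chainCos_mul (P := P) (e := False) (chainCos_ne_zero hPQ) ?_
    (by simpa using hd)
  intro d hd
  rw [iff_false, Nat.not_even_iff_odd] at hd
  -- With c = 0 the series e^{-Λ} is even, so its coefficient in odd degree equals its own negative.
  have h2 := coeff_arctanProd_neg (0 : ℂ) (-b) d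
  rw [neg_zero, hd.neg_one_pow] at h2
  have hd0 : d ≠ 0 := by
    rintro rfl
    simp at hd
  classical
  rw [mul_sub, h1, chainCos_mul_altSeries hPQ, add_sub_add_right_eq_sub, map_sub,
    MvPowerSeries.coeff_one, if_neg hd0, zero_sub, neg_eq_zero]
  linear_combination h2 / 2

end Comparison

/-! ### Symmetric functions as polynomials in the power sums -/

section Symmetric

open Classical in
lemma coeff_elemSymm (m : ℕ) (d : ℕ →₀ ℕ) : MvPowerSeries.coeff d (elemSymm m) =
    if d.degree = m ∧ ∀ i, d i ≤ 1 then 1 else 0 := rfl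

open Classical in
lemma coeff_complSymm (m : ℕ) (d : ℕ →₀ ℕ) : MvPowerSeries.coeff d (complSymm m) =
    if d.degree = m then 1 else 0 := rfl

open Classical in
lemma coeff_powerSum (m : ℕ) (d : ℕ →₀ ℕ) : MvPowerSeries.coeff d (powerSum m) =
    if ∃ i, d = Finsupp.single i m then 1 else 0 := rfl

lemma coeff_powerSum_mul {m : ℕ} (hm : m ≠ 0) (f : MvPowerSeries ℕ ℚ) (d : ℕ →₀ ℕ) :
    MvPowerSeries.coeff d (powerSum m * f) =
      ∑ j ∈ d.support with m ≤ d j, MvPowerSeries.coeff (d - Finsupp.single j m) f := by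
  classical
  rw [MvPowerSeries.coeff_mul]
  simp only [coeff_powerSum, ite_mul, one_mul, zero_mul]
  rw [← Finset.sum_filter]
  symm
  refine Finset.sum_bij (fun j _ => (Finsupp.single j m, d - Finsupp.single j m)) ?_ ?_ ?_ ?_
  · intro j hj
    rw [Finset.mem_filter, mem_antidiagonal]
    refine ⟨add_tsub_cancel_of_le ?_, j, rfl⟩
    exact Finsupp.single_le_iff.mpr (Finset.mem_filter.mp hj).2
  · intro j _ j' _ h
    exact Finsupp.single_left_injective hm (Prod.ext_iff.mp h).1
  · rintro ⟨x, y⟩ h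
    rw [Finset.mem_filter, mem_antidiagonal] at h
    obtain ⟨h, j, hj⟩ := h
    dsimp only at h hj
    subst hj
    have : m ≤ d j := by simp [← h]
    refine ⟨j, ?_, by simp [← h]⟩
    rw [Finset.mem_filter, Finsupp.mem_support_iff]
    exact ⟨by omega, this⟩
  · intro j _
    rfl

/-- A monomial of degree m + 1 arises once for each power x_j^{i+1} dividing it. The variable x_j
has d_j such powers, and these numbers add up to m + 1. -/
lemma complSymm_newton (m : ℕ) : ((m : MvPowerSeries ℕ ℚ) + 1) * complSymm (m + 1) =
    ∑ i ∈ Finset.range (m + 1), powerSum (i + 1) * complSymm (m - i) := by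
  classical
  ext d
  have hC : ((m : MvPowerSeries ℕ ℚ) + 1) = MvPowerSeries.C (m + 1 : ℚ) := by simp
  rw [hC, MvPowerSeries.coeff_C_mul, map_sum]
  simp only [coeff_powerSum_mul (Nat.succ_ne_zero _), coeff_complSymm]
  have key : ∀ i ∈ Finset.range (m + 1), ∀ j, i + 1 ≤ d j →
      ((d - Finsupp.single j (i + 1)).degree = m - i ↔ d.degree = m + 1) := by
    intro i hi j hj
    have h := congrArg Finsupp.degree (tsub_add_cancel_of_le (Finsupp.single_le_iff.mpr hj))
    rw [map_add, Finsupp.degree_single] at h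
    have := Finset.mem_range.mp hi
    omega
  have step : ∀ i ∈ Finset.range (m + 1),
      (∑ j ∈ d.support with i + 1 ≤ d j,
        if (d - Finsupp.single j (i + 1)).degree = m - i then (1 : ℚ) else 0) =
      ∑ j ∈ d.support, if i + 1 ≤ d j then (if d.degree = m + 1 then (1 : ℚ) else 0) else 0 := by
    intro i hi
    rw [Finset.sum_filter]
    refine Finset.sum_congr rfl fun j _ => ?_
    by_cases h : i + 1 ≤ d j
    · simp only [h, if_true, key i hi j h]
    · simp only [h, if_false]
  rw [Finset.sum_congr rfl step, Finset.sum_comm]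
  by_cases hd : d.degree = m + 1
  · simp only [hd, if_true, mul_one]
    have : ∀ j ∈ d.support,
        (∑ i ∈ Finset.range (m + 1), if i + 1 ≤ d j then (1 : ℚ) else 0) = d j := by
      intro j _
      have hle : d j ≤ m + 1 := hd ▸ Finsupp.le_degree j d
      rw [Finset.sum_boole]
      have : (Finset.range (m + 1)).filter (fun i => i + 1 ≤ d j) = Finset.range (d j) := by
        ext i
        simp only [Finset.mem_filter, Finset.mem_range]
        omega
      rw [this, Finset.card_range]
    rw [Finset.sum_congr rfl this, ← Nat.cast_sum, ← Finsupp.degree_apply, hd]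
    push_cast
    rfl
  · simp [hd]

lemma complSymm_eq_newton (m : ℕ) : complSymm m = newton (fun i => powerSum (i + 1)) m := by
  refine congrFun (eq_newton ?_ complSymm_newton) m
  classical
  ext d
  rw [coeff_complSymm, MvPowerSeries.coeff_one]
  simp [Finsupp.degree_eq_zero_iff]

/-- Setting all but the first `N` variables to zero. -/
noncomputable def truncate (N : ℕ) : MvPowerSeries ℕ ℚ →ₐ[ℚ] MvPowerSeries (Fin N) ℚ :=
  MvPowerSeries.killCompl Fin.valEmbedding

lemma coeff_truncate {N : ℕ} (f : MvPowerSeries ℕ ℚ) (x : Fin N →₀ ℕ) :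
    MvPowerSeries.coeff x (truncate N f) =
      MvPowerSeries.coeff (x.embDomain Fin.valEmbedding) f :=
  MvPowerSeries.coeff_killCompl f x

lemma ext_truncate {f g : MvPowerSeries ℕ ℚ} (h : ∀ N, truncate N f = truncate N g) : f = g := by
  ext d
  obtain ⟨x, hx⟩ : ∃ x : Fin (d.support.sup id + 1) →₀ ℕ,
      x.embDomain Fin.valEmbedding = d := by
    rw [← Set.mem_range, Finsupp.mem_range_embDomain_iff]
    intro j hj
    have := Finset.le_sup (f := id) hj
    exact ⟨⟨j, Nat.lt_succ_of_le this⟩, rfl⟩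
  rw [← hx, ← coeff_truncate, ← coeff_truncate, h]

lemma truncate_elemSymm (N m : ℕ) :
    truncate N (elemSymm m) = (MvPolynomial.esymm (Fin N) ℚ m : MvPowerSeries (Fin N) ℚ) := by
  classical
  ext x
  rw [coeff_truncate, coeff_elemSymm, MvPolynomial.coeff_coe, MvPolynomial.esymm_eq_sum_monomial,
    MvPolynomial.coeff_sum]
  simp only [MvPolynomial.coeff_monomial]
  have hdeg : (x.embDomain Fin.valEmbedding).degree = x.degree := by
    rw [Finsupp.degree_apply, Finsupp.degree_apply, Finsupp.support_embDomain, Finset.sum_map]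
    exact Finset.sum_congr rfl fun j _ => Finsupp.embDomain_apply_self _ _ _
  have hle : (∀ i, x.embDomain Fin.valEmbedding i ≤ 1) ↔ ∀ i, x i ≤ 1 := by
    constructor
    · intro h i
      have := h (Fin.valEmbedding i)
      rwa [Finsupp.embDomain_apply_self] at this
    · intro h i
      by_cases hi : i ∈ Set.range (Fin.valEmbedding : Fin N ↪ ℕ)
      · obtain ⟨j, rfl⟩ := hi
        rw [Finsupp.embDomain_apply_self]
        exact h j
      · rw [Finsupp.embDomain_of_notMem_range _ _ _ hi]
        exact zero_le_one
  have hsum : ∀ (t : Finset (Fin N)) i, (∑ j ∈ t, Finsupp.single j 1) i = if i ∈ t then 1 else 0 := by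
    intro t i
    simp [Finsupp.finsetSum_apply, Finsupp.single_apply]
  rw [hdeg, hle]
  split_ifs with h
  · have hx : ∑ j ∈ x.support, Finsupp.single j 1 = x := by
      ext i
      rw [hsum]
      have := h.2 i
      split_ifs with hi
      · rw [Finsupp.mem_support_iff] at hi
        omega
      · rw [Finsupp.notMem_support_iff] at hi
        exact hi.symm
    rw [Finset.sum_eq_single x.support, if_pos hx]
    · intro t _ hne
      rw [if_neg]
      rintro rfl
      apply hne
      ext i
      rw [Finsupp.mem_support_iff, hsum]
      simp
    · intro hmem
      refine absurd ?_ hmem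
      rw [Finset.mem_powersetCard_univ, ← h.1]
      conv_rhs => rw [← hx]
      simp [map_sum]
  · rw [Finset.sum_eq_zero]
    intro t ht
    rw [if_neg]
    rintro rfl
    refine h ⟨?_, fun i => ?_⟩
    · simpa [map_sum] using (Finset.mem_powersetCard_univ.mp ht)
    · rw [hsum]
      split_ifs <;> simp

lemma truncate_powerSum (N m : ℕ) (hm : m ≠ 0) :
    truncate N (powerSum m) = (MvPolynomial.psum (Fin N) ℚ m : MvPowerSeries (Fin N) ℚ) := by
  classical
  ext x
  rw [coeff_truncate, coeff_powerSum, MvPolynomial.coeff_coe, MvPolynomial.psum,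
    MvPolynomial.coeff_sum]
  simp only [MvPolynomial.coeff_X_pow]
  split_ifs with h
  · obtain ⟨i, hi⟩ := h
    have hi' : i ∈ Set.range (Fin.valEmbedding : Fin N ↪ ℕ) := by
      by_contra hcon
      have := DFunLike.congr_fun hi i
      rw [Finsupp.embDomain_of_notMem_range _ _ _ hcon, Finsupp.single_eq_same] at this
      exact hm this.symm
    obtain ⟨j, rfl⟩ := hi'
    rw [← Finsupp.embDomain_single, Finsupp.embDomain_inj] at hi
    subst hi
    rw [Finset.sum_eq_single j, if_pos rfl]
    · intro j' _ hne
      rw [if_neg]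
      exact fun h => hne (Finsupp.single_left_injective hm h)
    · simp
  · rw [Finset.sum_eq_zero]
    intro j _
    rw [if_neg]
    rintro rfl
    exact h ⟨j, by rw [Finsupp.embDomain_single]; rfl⟩

lemma esymm_newton (N m : ℕ) : ((m : MvPolynomial (Fin N) ℚ) + 1) *
    MvPolynomial.esymm (Fin N) ℚ (m + 1) = ∑ i ∈ Finset.range (m + 1),
      (-1) ^ i * MvPolynomial.psum (Fin N) ℚ (i + 1) * MvPolynomial.esymm (Fin N) ℚ (m - i) := by
  have h := MvPolynomial.mul_esymm_eq_sum (Fin N) ℚ (m + 1)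
  push_cast at h
  -- The sum is indexed by the degree of the elementary factor; reflecting it indexes it by the
  -- power sum instead.
  rw [h, Finset.sum_filter, Finset.Nat.sum_antidiagonal_eq_sum_range_succ_mk,
    Finset.sum_range_succ, if_neg (lt_irrefl _), add_zero,
    ← Finset.sum_range_reflect, Finset.mul_sum]
  refine Finset.sum_congr rfl fun i hi => ?_
  have hi := Finset.mem_range.mp hi
  obtain ⟨j, rfl⟩ := Nat.exists_eq_add_of_le (Nat.lt_succ_iff.mp hi)
  have e1 : i + j + 1 - 1 - i = j := by omega
  have e2 : i + j + 1 - j = i + 1 := by omega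
  have e3 : i + j - i = j := by omega
  dsimp only
  rw [e1, if_pos (by omega), e2, e3]
  have : (-1 : MvPolynomial (Fin N) ℚ) ^ (i + j + 1 + 1) * (-1) ^ j = (-1) ^ i := by
    rw [← pow_add, show i + j + 1 + 1 + j = i + 2 * (j + 1) by ring, pow_add, pow_mul]
    simp
  rw [← this]
  ring

lemma elemSymm_newton (m : ℕ) : ((m : MvPowerSeries ℕ ℚ) + 1) * elemSymm (m + 1) =
    ∑ i ∈ Finset.range (m + 1), (-1) ^ i * powerSum (i + 1) * elemSymm (m - i) := by
  refine ext_truncate fun N => ?_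
  have h := congrArg (MvPolynomial.coeToMvPowerSeries.ringHom (R := ℚ)) (esymm_newton N m)
  have hneg : ((-1 : MvPolynomial (Fin N) ℚ) : MvPowerSeries (Fin N) ℚ) = -1 :=
    by simpa using map_neg (MvPolynomial.coeToMvPowerSeries.ringHom (R := ℚ) (σ := Fin N)) 1
  have hnat : ((m : MvPolynomial (Fin N) ℚ) : MvPowerSeries (Fin N) ℚ) = m :=
    map_natCast (MvPolynomial.coeToMvPowerSeries.ringHom (R := ℚ)) m
  simpa [map_sum, truncate_elemSymm, truncate_powerSum, hneg, hnat] using h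

lemma elemSymm_eq_newton (m : ℕ) :
    elemSymm m = newton (fun i => (-1) ^ i * powerSum (i + 1)) m := by
  refine congrFun (eq_newton (ext_truncate fun N => ?_) elemSymm_newton) m
  simp [truncate_elemSymm]

/-- The elementary symmetric function of degree `m` as a polynomial in the power sums. -/
noncomputable def elemPoly (m : ℕ) : MvPolynomial ℕ ℚ :=
  newton (fun i => (-1) ^ i * MvPolynomial.X i) m

/-- The complete symmetric function of degree `m` as a polynomial in the power sums. -/
noncomputable def complPoly (m : ℕ) : MvPolynomial ℕ ℚ := newton MvPolynomial.X m

lemma evalPowerSums_elemPoly (m : ℕ) : evalPowerSums (elemPoly m) = elemSymm m := by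
  rw [elemSymm_eq_newton, elemPoly]
  refine (map_newton (evalPowerSums : MvPolynomial ℕ ℚ →+* MvPowerSeries ℕ ℚ) _ m).trans ?_
  simp [evalPowerSums]

lemma evalPowerSums_complPoly (m : ℕ) : evalPowerSums (complPoly m) = complSymm m := by
  rw [complSymm_eq_newton, complPoly]
  refine (map_newton (evalPowerSums : MvPolynomial ℕ ℚ →+* MvPowerSeries ℕ ℚ) _ m).trans ?_
  simp [evalPowerSums]

/-- A relation involves finitely many variables, so it survives truncation to N variables, where the
first N elementary symmetric polynomials are algebraically independent. -/
lemma aeval_elemSymm_injective : Function.Injective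
    (MvPolynomial.aeval fun m => elemSymm (m + 1) : MvPolynomial ℕ ℚ →ₐ[ℚ] _) := by
  rw [injective_iff_map_eq_zero]
  intro Q hQ
  let N := Q.vars.sup id + 1
  obtain ⟨q, hq⟩ := MvPolynomial.exists_rename_eq_of_vars_subset_range Q
    (Fin.val : Fin N → ℕ) Fin.val_injective fun j hj =>
      ⟨⟨j, Nat.lt_succ_of_le (Finset.le_sup (f := id) hj)⟩, rfl⟩
  rw [← hq] at hQ ⊢
  have h : ((MvPolynomial.aeval (fun i : Fin N => MvPolynomial.esymm (Fin N) ℚ (i + 1)) q :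
      MvPolynomial (Fin N) ℚ) : MvPowerSeries (Fin N) ℚ) = 0 := by
    have h := congrArg (truncate N) hQ
    rw [MvPolynomial.aeval_rename, map_zero, ← AlgHom.comp_apply, MvPolynomial.comp_aeval] at h
    have h2 := DFunLike.congr_fun (MvPolynomial.comp_aeval
      (fun i : Fin N => MvPolynomial.esymm (Fin N) ℚ (i + 1))
      (MvPolynomial.coeToMvPowerSeries.algHom ℚ (R := ℚ) (σ := Fin N))) q
    rw [← h]
    convert h2 using 2
    · simp
    · congr 1
      funext i
      simp [truncate_elemSymm]
  rw [MvPolynomial.coe_eq_zero_iff, ← MvPolynomial.esymmAlgHom_apply] at h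
  have := MvPolynomial.esymmAlgHom_fin_injective ℚ (le_refl N)
    ((Subtype.ext h).trans (map_zero (MvPolynomial.esymmAlgHom (Fin N) ℚ N)).symm)
  rw [this, map_zero]

/-- Newton's identity can be solved for its last power sum, whose coefficient is ±1. -/
lemma aeval_elemPoly_surjective : Function.Surjective
    (MvPolynomial.aeval fun m => elemPoly (m + 1) : MvPolynomial ℕ ℚ →ₐ[ℚ] _) := by
  set ψ := (MvPolynomial.aeval fun m => elemPoly (m + 1) :
    MvPolynomial ℕ ℚ →ₐ[ℚ] MvPolynomial ℕ ℚ) with hψ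
  have hE : ∀ m, elemPoly m ∈ ψ.range := by
    rintro (_ | m)
    · simp [elemPoly]
    · exact ⟨MvPolynomial.X m, by simp [hψ]⟩
  have hX : ∀ m, MvPolynomial.X m ∈ ψ.range := by
    intro m
    induction m using Nat.strong_induction_on with
    | _ m ih =>
      have h := newton_succ (fun i => (-1) ^ i * MvPolynomial.X (R := ℚ) i) m
      rw [Finset.sum_range_succ, Nat.sub_self, newton_zero, mul_one, ← sub_eq_iff_eq_add'] at h
      have hneg : ∀ i, (-1 : MvPolynomial ℕ ℚ) ^ i ∈ ψ.range := fun i =>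
        pow_mem (neg_mem (one_mem _)) i
      have h1 : (-1) ^ m * MvPolynomial.X m ∈ ψ.range := by
        rw [← h]
        refine sub_mem (mul_mem (add_mem (natCast_mem _ m) (one_mem _)) (hE (m + 1)))
          (sum_mem fun i hi => mul_mem (mul_mem (hneg i) (ih i (Finset.mem_range.mp hi)))
            (hE (m - i)))
      have h2 := mul_mem (hneg m) h1
      rwa [← mul_assoc, ← pow_add, Even.neg_one_pow ⟨m, rfl⟩, one_mul] at h2
  rw [← AlgHom.range_eq_top, eq_top_iff, ← MvPolynomial.adjoin_range_X]
  exact Algebra.adjoin_le (Set.range_subset_iff.mpr hX)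

/-- Independence passes from the elementary symmetric functions to the power sums: the composite
with a surjective change of generators is injective. -/
lemma evalPowerSums_injective : Function.Injective evalPowerSums := by
  have h : evalPowerSums.comp (MvPolynomial.aeval fun m => elemPoly (m + 1)) =
      (MvPolynomial.aeval fun m => elemSymm (m + 1) : MvPolynomial ℕ ℚ →ₐ[ℚ] _) := by
    rw [MvPolynomial.comp_aeval]
    simp [evalPowerSums_elemPoly]
  have hinj := aeval_elemSymm_injective
  rw [← h, AlgHom.coe_comp] at hinj
  exact hinj.of_comp_right aeval_elemPoly_surjective

lemma bracket_evalPowerSums (P : MvPolynomial ℕ ℚ) (a : ℕ → ℚ[X]) :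
    bracket (evalPowerSums P) a = MvPolynomial.aeval a P := by
  have h : ∃ Q, evalPowerSums Q = evalPowerSums P := ⟨P, rfl⟩
  have h2 : powerSumPoly (evalPowerSums P) = P := by
    rw [powerSumPoly, dif_pos h]
    exact evalPowerSums_injective h.choose_spec
  rw [bracket, h2]

lemma bracket_symmProd {n : ℕ} (α : Composition n) (A B : Finset (Fin α.length))
    (a : ℕ → ℚ[X]) :
    bracket (symmProd α A B) a =
      (∏ i ∈ A, newton (fun i => (-1) ^ i * a i) (α.blocksFun i)) *
        ∏ j ∈ B, newton a (α.blocksFun j) := by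
  have hP : symmProd α A B = evalPowerSums ((∏ i ∈ A, elemPoly (α.blocksFun i)) *
      ∏ j ∈ B, complPoly (α.blocksFun j)) := by
    simp [symmProd, evalPowerSums_elemPoly, evalPowerSums_complPoly]
  have h1 : ∀ m, MvPolynomial.aeval a (elemPoly m) = newton (fun i => (-1) ^ i * a i) m := by
    intro m
    refine (map_newton ((MvPolynomial.aeval a : MvPolynomial ℕ ℚ →ₐ[ℚ] ℚ[X]) :
      MvPolynomial ℕ ℚ →+* ℚ[X]) _ m).trans ?_
    simp
  have h2 : ∀ m, MvPolynomial.aeval a (complPoly m) = newton a m := by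
    intro m
    refine (map_newton ((MvPolynomial.aeval a : MvPolynomial ℕ ℚ →ₐ[ℚ] ℚ[X]) :
      MvPolynomial ℕ ℚ →+* ℚ[X]) _ m).trans ?_
    simp
  rw [hP, bracket_evalPowerSums]
  simp [h1, h2]

end Symmetric

/-! ### Counting alternating words -/

section Counting

variable {ι : Type*} [Fintype ι]

open Classical in
/-- `1` on a set of letters, and `-1` elsewhere. -/
noncomputable def signs (B : Finset ι) (j : ι) : ℂ := if j ∈ B then 1 else -1

lemma coeff_arctanProd_I [LinearOrder ι] {B : Finset ι} {P : ι → ι → Prop}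
    (hP : ∀ a b, P a b ↔ a < b ∨ (a = b ∧ a ∈ B)) (d : ι →₀ ℕ) :
    MvPowerSeries.coeff d (arctanProd Complex.I (-signs B)) =
      Complex.I ^ d.degree * MvPowerSeries.coeff d (chainSeries ℂ P) := by
  classical
  rw [coeff_chainSeries_of_linearOrder B hP, coeff_arctanProd, Finsupp.degree_eq_sum,
    ← Finset.prod_pow_eq_pow_sum, ← Finset.prod_mul_distrib]
  refine Finset.prod_congr rfl fun j _ => ?_
  by_cases h : j ∈ B
  · simp [signs, h, newton_altPeriodic_I_neg_one]
  · simp [signs, h, newton_altPeriodic_I_one]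

lemma coeff_arctanProd_I_ascRel {k : ℕ} (B : Finset (Fin k)) (d : Fin k →₀ ℕ) :
    MvPowerSeries.coeff d (arctanProd Complex.I (-signs B)) =
      Complex.I ^ d.degree * MvPowerSeries.coeff d (chainSeries ℂ (AscRel B)) :=
  coeff_arctanProd_I (fun _ _ => Iff.rfl) d

lemma coeff_arctanProd_I_descRel {k : ℕ} (A : Finset (Fin k)) (d : Fin k →₀ ℕ) :
    MvPowerSeries.coeff d (arctanProd Complex.I (-signs A)) =
      Complex.I ^ d.degree * MvPowerSeries.coeff d (chainSeries ℂ (DescRel A)) :=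
  -- Descending chains are ascending chains for the reversed order.
  @coeff_arctanProd_I (Fin k) _ (OrderDual.instLinearOrder (Fin k)) A (DescRel A)
    (fun _ _ => Iff.rfl) d

lemma ascRel_iff_not_descRel {k : ℕ} {A B : Finset (Fin k)} (h : IsCompl A B) (a b : Fin k) :
    AscRel B a b ↔ ¬ DescRel A a b := by
  rw [← h.compl_eq, AscRel, DescRel, Finset.mem_compl]
  rcases lt_trichotomy a b with hab | rfl | hab
  · simp [hab, hab.not_gt, hab.ne]
  · simp
  · simp [hab, hab.not_gt, hab.ne']

lemma descRel_iff_not_ascRel {k : ℕ} {A B : Finset (Fin k)} (h : IsCompl A B) (a b : Fin k) :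
    DescRel A a b ↔ ¬ AscRel B a b := by
  rw [ascRel_iff_not_descRel h, not_not]

lemma coeff_altSeries_eq_card {n : ℕ} (P Q : ι → ι → Prop) (d : ι →₀ ℕ) (h : d.degree = n) :
    MvPowerSeries.coeff d (altSeries ℂ P Q) =
      (Nat.card {w : Fin n → ι // content w = d ∧ AlternatesBy P Q w} : ℂ) := by
  subst h
  rw [coeff_altSeries, coeff_wordSum]

/-! ### Euler numbers -/

/-- The content of a permutation of all letters. -/
noncomputable def allOnes (m : ℕ) : Fin m →₀ ℕ := Finsupp.equivFunOnFinite.symm 1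

lemma degree_allOnes (m : ℕ) : (allOnes m).degree = m := by
  simp [allOnes, Finsupp.degree_eq_sum]

lemma content_eq_allOnes_iff {m : ℕ} (w : Fin m → Fin m) :
    content w = allOnes m ↔ Function.Bijective w := by
  rw [DFunLike.ext_iff, Function.bijective_iff_existsUnique]
  refine forall_congr' fun j => ?_
  rw [content_apply]
  simp [allOnes, Finset.card_eq_one, Finset.ext_iff, ExistsUnique, iff_def, forall_and,
    and_comm]

lemma eulerNumber_eq_card (m : ℕ) : eulerNumber m = Nat.card {w : Fin m → Fin m //
    content w = allOnes m ∧ AlternatesBy (DescRel ∅) (AscRel Finset.univ) w} := by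
  have h : ∀ w : Fin m → Fin m, Function.Injective w →
      (AlternatesBy (· > ·) (· < ·) w ↔ AlternatesBy (DescRel ∅) (AscRel Finset.univ) w) := by
    intro w hw
    refine forall_congr' fun i => forall_congr' fun hi => ?_
    have hne : w i ≠ w ⟨i + 1, hi⟩ := fun h => by
      have := congrArg Fin.val (hw h)
      simp at this
    simp [DescRel, AscRel, hne]
  refine Nat.card_congr ?_
  exact
    { toFun := fun w => ⟨w.1, (content_eq_allOnes_iff _).mpr w.1.bijective,
        (h _ w.1.injective).mp w.2⟩
      invFun := fun w => ⟨Equiv.ofBijective w.1 ((content_eq_allOnes_iff _).mp w.2.1),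
        (h _ ((content_eq_allOnes_iff _).mp w.2.1).1).mpr w.2.2⟩
      left_inv := fun w => by
        ext
        rfl
      right_inv := fun w => rfl }

/-- The part of e^{Xθ + Λ} linear in every variable is X^m times the product of the variables,
whatever b is. -/
lemma coeff_umbralSeries_allOnes {m : ℕ} (b : Fin m → ℂ) :
    MvPowerSeries.coeff (allOnes m) (umbralSeries b) = secTan m := by
  have h : ∀ c b : ℂ[X], newton (altPeriodic c b) 1 = c := fun c b => by
    have := newton_succ (altPeriodic c b) 0
    simpa [altPeriodic] using this
  rw [coeff_umbralSeries, coeff_arctanProd]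
  simp [allOnes, h, umbralMap_X_pow]

lemma secTan_eq_eulerNumber (m : ℕ) : secTan m = eulerNumber m := by
  have hc : IsCompl (∅ : Finset (Fin m)) Finset.univ := isCompl_bot_top
  rw [eulerNumber_eq_card, ← coeff_altSeries_eq_card _ _ _ (degree_allOnes m)]
  rcases Nat.even_or_odd m with hm | hm
  · rw [coeff_altSeries_of_even (ascRel_iff_not_descRel hc) (coeff_arctanProd_I_descRel _)
      (by rwa [degree_allOnes]), coeff_umbralSeries_allOnes]
  · rw [coeff_altSeries_of_odd (ascRel_iff_not_descRel hc) (coeff_arctanProd_I_descRel _)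
      (by rwa [degree_allOnes]), coeff_umbralSeries_allOnes]

lemma umbral_eq_umbralMap (q : ℚ[X]) :
    (umbral q : ℂ) = umbralMap (q.map (algebraMap ℚ ℂ)) := by
  rw [umbralMap_apply, umbral, Polynomial.sum_def, Polynomial.sum_def,
    Polynomial.support_map_of_injective _ (algebraMap ℚ ℂ).injective]
  push_cast
  refine Finset.sum_congr rfl fun m _ => ?_
  rw [Polynomial.coeff_map, secTan_eq_eulerNumber]
  simp

/-! ### Compositions -/

/-- A composition as the content of its words. -/
noncomputable def blocksFinsupp {n : ℕ} (α : Composition n) : Fin α.length →₀ ℕ :=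
  Finsupp.equivFunOnFinite.symm α.blocksFun

lemma degree_blocksFinsupp {n : ℕ} (α : Composition n) : (blocksFinsupp α).degree = n := by
  simp [blocksFinsupp, Finsupp.degree_eq_sum, α.sum_blocksFun]

lemma content_eq_blocksFinsupp_iff {n : ℕ} (α : Composition n) (w : Fin n → Fin α.length) :
    content w = blocksFinsupp α ↔ IsMultisetPerm α w := by
  rw [DFunLike.ext_iff]
  refine forall_congr' fun j => ?_
  rw [content_apply]
  rfl

lemma card_isMultisetPerm {n : ℕ} (α : Composition n) (P Q : Fin α.length → Fin α.length → Prop) :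
    (Nat.card {w : Fin n → Fin α.length // IsMultisetPerm α w ∧ AlternatesBy P Q w} : ℂ) =
      MvPowerSeries.coeff (blocksFinsupp α) (altSeries ℂ P Q) := by
  rw [coeff_altSeries_eq_card _ _ _ (degree_blocksFinsupp α)]
  simp only [content_eq_blocksFinsupp_iff]

/-- Passing from h to e multiplies the sequence by (-1)^i, which negates β; so letters of `A` carry
-β and letters of `B` carry β. -/
lemma umbral_bracket_symmProd {n : ℕ} (α : Composition n) {A B : Finset (Fin α.length)}
    (hAB : IsCompl A B) (β : ℚ) :
    (umbral (bracket (symmProd α A B) (altPeriodic X (C β))) : ℂ) =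
      MvPowerSeries.coeff (blocksFinsupp α) (umbralSeries fun j => β * signs B j) := by
  rw [umbral_eq_umbralMap, coeff_umbralSeries, bracket_symmProd, coeff_arctanProd]
  congr 1
  rw [neg_one_pow_mul_altPeriodic, ← Polynomial.coe_mapRingHom, map_mul, map_prod, map_prod,
    ← hAB.compl_eq, mul_comm, ← Finset.prod_compl_mul_prod A]
  congr 1
  all_goals
    refine Finset.prod_congr rfl fun j hj => ?_
    rw [map_newton, map_altPeriodic]
  · simp [signs, Finset.mem_compl.mp hj, blocksFinsupp]
  · simp [signs, hj, blocksFinsupp]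

lemma signs_of_isCompl {A B : Finset ι} (hAB : IsCompl A B) : signs A = -signs B := by
  classical
  funext j
  rw [← hAB.compl_eq]
  by_cases h : j ∈ A <;> simp [signs, h]

end Counting

end UmbralAlternating

open UmbralAlternating
theorem mainTheorem12 (n : ℕ) (hn : 1 ≤ n) (α : Composition n)
    (A B : Finset (Fin α.length)) (hAB : IsCompl A B) :
    (Odd n →
      UmbralAlternating.altCount α A B = UmbralAlternating.revAltCount α A B ∧
      (UmbralAlternating.revAltCount α A B : ℚ) =
        UmbralAlternating.umbral (UmbralAlternating.bracket
          (UmbralAlternating.symmProd α A B)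
          (UmbralAlternating.periodicSeq X 0 (-X) 0))) ∧
    (Even n →
      (UmbralAlternating.altCount α A B : ℚ) =
        UmbralAlternating.umbral (UmbralAlternating.bracket
          (UmbralAlternating.symmProd α A B)
          (UmbralAlternating.periodicSeq X (-1) (-X) 1)) ∧
      (UmbralAlternating.revAltCount α A B : ℚ) =
        UmbralAlternating.umbral (UmbralAlternating.bracket
          (UmbralAlternating.symmProd α A B)
          (UmbralAlternating.periodicSeq X 1 (-X) (-1)))) := by
  have hasc := ascRel_iff_not_descRel hAB
  have hdesc := descRel_iff_not_ascRel hAB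
  have hN := card_isMultisetPerm α (DescRel A) (AscRel B)
  have hN' := card_isMultisetPerm α (AscRel B) (DescRel A)
  have hper : ∀ β : ℚ, periodicSeq X (C β) (-X) (-C β) = altPeriodic X (C β) := fun β =>
    periodicSeq_eq_altPeriodic _ _
  refine ⟨fun hodd => ?_, fun heven => ?_⟩
  · have hd : Odd (blocksFinsupp α).degree := by rwa [degree_blocksFinsupp]
    rw [coeff_altSeries_of_odd hasc (coeff_arctanProd_I_descRel A) hd] at hN
    rw [coeff_altSeries_of_odd hdesc (coeff_arctanProd_I_ascRel B) hd] at hN'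
    -- Both counts are the same coefficient of `umbralSeries 0`.
    refine ⟨Nat.cast_injective (R := ℂ) (hN.trans hN'.symm), ?_⟩
    have h := umbral_bracket_symmProd α hAB 0
    have h0 : (fun j => ((0 : ℚ) : ℂ) * signs B j) = 0 := by
      funext j
      simp
    rw [← hper, h0, ← hN'] at h
    simp only [map_zero, neg_zero] at h
    exact_mod_cast h.symm
  · have hd : Even (blocksFinsupp α).degree := by rwa [degree_blocksFinsupp]
    rw [coeff_altSeries_of_even hasc (coeff_arctanProd_I_descRel A) hd] at hN
    rw [coeff_altSeries_of_even hdesc (coeff_arctanProd_I_ascRel B) hd] at hN'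
    constructor
    · have h := umbral_bracket_symmProd α hAB (-1)
      have h0 : (fun j => ((-1 : ℚ) : ℂ) * signs B j) = signs A := by
        rw [signs_of_isCompl hAB]
        funext j
        simp
      rw [← hper, h0, ← hN] at h
      simp only [map_neg, map_one, neg_neg] at h
      exact_mod_cast h.symm
    · have h := umbral_bracket_symmProd α hAB 1
      have h0 : (fun j => ((1 : ℚ) : ℂ) * signs B j) = signs B := by
        funext j
        simp
      rw [← hper, h0, ← hN'] at h
      simp only [map_one] at h
      exact_mod_cast h.symm
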